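/- Let $s\ge 3$ be a fixed integer and put $$q_s(n)=n^{-\frac{2}{s+1}}(\ln n)^{\frac{2}{(s-2)(s+1)}},\qquad c_s=\left[2\left(1-\frac1{s+1}\right)(s-2)!\right]^{\frac{2}{(s+1)(s-2)}}.$$ Let $G(n,p)$ be the binomial random graph on $n$ vertices, in which every edge is present with probability $p$ independently of the others, and let $\mathcal B_s$ be the property of a graph that every edge lies in a copy of $K_s$. Write "whp" for "with probability tending to $1$ as $n\to\infty$". Let $(w_n)$ be a sequence of reals and $(p(n))$ a sequence in $[0,1]$ such that, for all sufficiently large $n$, $$p(n)=c_s\,q_s(n)\left[1+\frac{2\ln\ln n}{(s-2)^2(s^2+s)\ln n}+\frac{w_n}{\ln n}\right].$$ (i) If $w_n\to\infty$, then whp $G(n,p(n))$ has $\mathcal B_s$. (ii) If $w_n\to-\infty$ and $n^2p(n)\to\infty$, then whp $G(n,p(n))$ does not have $\mathcal B_s$, i.e. some edge lies in no copy of $K_s$. In particular, $c_sq_s(n)$ is a sharp threshold for $\mathcal B_s$ (among $p$ with $n^2p\to\infty$): for every fixed $\varepsilon>0$ and every sequence $(p(n))$ in $[0,1]$, if $p(n)\ge(1+\varepsilon)c_sq_s(n)$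 for all large $n$, then whp $G(n,p(n))$ has $\mathcal B_s$; and if $p(n)\le(1-\varepsilon)c_sq_s(n)$ for all large $n$ and $n^2p(n)\to\infty$, then whp $G(n,p(n))$ does not have $\mathcal B_s$. -/

import Mathlib

open Filter Topology

/-- The property that every edge of `G` lies in a copy of `K_s`, i.e. that its two ends lie
in a common clique with `s` vertices. -/
def EveryEdgeInClique (s : ℕ) {V : Type*} (G : SimpleGraph V) : Prop :=
  ∀ u v : V, G.Adj u v → ∃ K : Finset V, G.IsNClique s K ∧ u ∈ K ∧ v ∈ K

/-- With high probability the binomial random graph `G(n, p n)` on `n` vertices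
has the property `P n`: the probability of the property tends to `1`. -/
def WhpRandomGraph (p : ℕ → unitInterval) (P : ∀ n : ℕ, SimpleGraph (Fin n) → Prop) : Prop :=
  Tendsto (fun n : ℕ => SimpleGraph.binomialRandom (Fin n) (p n) {G | P n G}) atTop (𝓝 1)

/-- `q_s(n) = n ^ (-2 / (s + 1)) * (ln n) ^ (2 / ((s - 2) (s + 1)))`. -/
noncomputable def cliqueScale (s n : ℕ) : ℝ :=
  (n : ℝ) ^ (-(2 / ((s : ℝ) + 1))) *
    Real.log n ^ (2 / (((s : ℝ) - 2) * ((s : ℝ) + 1)))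

/-- `c_s = [2 (1 - 1 / (s + 1)) (s - 2)!] ^ (2 / ((s + 1) (s - 2)))`. -/
noncomputable def cliqueConst (s : ℕ) : ℝ :=
  (2 * (1 - 1 / ((s : ℝ) + 1)) * ((s - 2).factorial : ℝ)) ^
    (2 / (((s : ℝ) + 1) * ((s : ℝ) - 2)))

/-- `c_s q_s(n) [1 + 2 ln ln n / ((s - 2)^2 (s^2 + s) ln n) + w / ln n]`. -/
noncomputable def edgeCliqueProb (s n : ℕ) (w : ℝ) : ℝ :=
  cliqueConst s * cliqueScale s n *
    (1 + 2 * Real.log (Real.log n) / (((s : ℝ) - 2) ^ 2 * ((s : ℝ) ^ 2 + s) * Real.log n)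
      + w / Real.log n)

/-! Write `s = k + 2`, let `m = k (k + 3) / 2` be the number of pairs that must be added to an edge
to make it a `K_s`, and let `M = n ^ k p ^ m / k!` be the approximate mean number of such extensions
of a given pair. A pair has no extension with probability about `exp (-M)`, so the mean number of
bad edges (edges in no `K_s`) is about `(n ^ 2 / 2) p exp (-M)`. The first moment decides when this
tends to `0`, the second moment when it tends to infinity.

The estimate of `exp (-M)` from above is Janson's inequality (`expect_avoids_le_exp`), from below
the positive correlation of decreasing events (`prod_one_sub_le_expect_avoids`). Janson applied to
the extensions of two pairs at once gives about `exp (-2 M)`, so distinct pairs are asymptotically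
uncorrelated. The dependence term is small because extensions sharing `j ≥ 1` vertices share at most
`(k + 2) j / 2` pairs (`two_mul_card_extension_inter_le`), while `n p ^ ((k + 2) / 2)` is at least
of order `n ^ (1 / (k + 3))` at the critical `p`.

At `p = t c_s q_s(n)` one has `M = A ln n * t ^ m` with `A = rate k`, and `n ^ 2 p exp (-M)` is
exactly `c_s t exp (A ln n (1 - t ^ m) + a ln ln n)` with `a = 2 / (k (k + 3))`. The `ln ln n` term
in the window makes `A m ln n (t - 1) = a ln ln n + A m w`, so near `t = 1` the exponent is about
`-A m w`: the sign of the limit of `w` decides. Sharpness follows because a factor `1 ± ε`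
corresponds to `|w|` of order `ln n`. -/

namespace RandomSubset

/-! ### Avoidance indicators. -/

section Avoids

variable {E ι : Type*} [DecidableEq E] {T : ι → Finset E} {J : Finset ι}

/-- The indicator of the event that none of the sets `T i`, `i ∈ J`, is contained in `ω`. -/
noncomputable def avoids (T : ι → Finset E) (J : Finset ι) (ω : Finset E) : ℝ :=
  ∏ i ∈ J, if T i ⊆ ω then 0 else 1

@[simp] lemma avoids_empty : avoids T ∅ = fun _ => 1 := rfl

lemma avoids_nonneg (ω : Finset E) : 0 ≤ avoids T J ω :=
  Finset.prod_nonneg fun i _ => by split_ifs <;> norm_num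

lemma avoids_le_one (ω : Finset E) : avoids T J ω ≤ 1 :=
  Finset.prod_le_one (fun i _ => by split_ifs <;> norm_num)
    fun i _ => by split_ifs <;> norm_num

lemma avoids_antitone : Antitone (avoids T J) := fun ω ω' h =>
  Finset.prod_le_prod (fun i _ => by split_ifs <;> norm_num) fun i _ => by
    by_cases hi : T i ⊆ ω
    · simp [hi, hi.trans h]
    · rw [if_neg hi]; split_ifs <;> norm_num

lemma avoids_eq_ite (ω : Finset E) [Decidable (∀ i ∈ J, ¬ T i ⊆ ω)] :
    avoids T J ω = if ∀ i ∈ J, ¬ T i ⊆ ω then 1 else 0 := by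
  split_ifs with h
  · exact Finset.prod_eq_one fun i hi => if_neg (h i hi)
  · push Not at h
    obtain ⟨i, hi, hT⟩ := h
    exact Finset.prod_eq_zero hi (if_pos hT)

lemma avoids_insert [DecidableEq ι] {i : ι} (hi : i ∉ J) (ω : Finset E) :
    avoids T (insert i J) ω = avoids T J ω - if T i ⊆ ω then avoids T J ω else 0 := by
  rw [avoids, Finset.prod_insert hi, ← avoids]
  split_ifs <;> ring

lemma avoids_union_eq {U : Finset E} (h : ∀ i ∈ J, Disjoint (T i) U) (ω : Finset E) :
    avoids T J (ω ∪ U) = avoids T J ω :=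
  Finset.prod_congr rfl fun i hi => by
    have : T i ⊆ ω ∪ U ↔ T i ⊆ ω := ⟨fun hs x hx => (Finset.mem_union.1 (hs hx)).resolve_right
      (Finset.disjoint_left.1 (h i hi) hx), fun hs => hs.trans Finset.subset_union_left⟩
    simp [this]

lemma one_sub_sum_le_avoids (ω : Finset E) :
    1 - ∑ i ∈ J, (if T i ⊆ ω then (1 : ℝ) else 0) ≤ avoids T J ω := by
  classical
  induction J using Finset.induction_on with
  | empty => simp [avoids]
  | insert i J hi ih =>
    rw [Finset.sum_insert hi, avoids_insert hi]
    have := avoids_le_one (T := T) (J := J) ω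
    split_ifs <;> linarith

end Avoids

/-! ### Product measures on subsets of a finite set. -/

variable {E : Type*} [Fintype E] [DecidableEq E]

/-- The probability that the random subset of `E` containing each `e` independently with
probability `p e` equals `ω`. -/
noncomputable def weight (p : E → ℝ) (ω : Finset E) : ℝ :=
  ∏ e, if e ∈ ω then p e else 1 - p e

/-- The expectation of `f` at the random subset of `E` containing each `e` independently with
probability `p e`. -/
noncomputable def expect (p : E → ℝ) (f : Finset E → ℝ) : ℝ :=
  ∑ ω, weight p ω * f ω

lemma weight_nonneg {p : E → ℝ} (h0 : ∀ e, 0 ≤ p e) (h1 : ∀ e, p e ≤ 1) (ω : Finset E) :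
    0 ≤ weight p ω :=
  Finset.prod_nonneg fun e _ => by
    split_ifs
    · exact h0 e
    · linarith [h1 e]

lemma expect_mono {p : E → ℝ} (h0 : ∀ e, 0 ≤ p e) (h1 : ∀ e, p e ≤ 1) {f g : Finset E → ℝ}
    (h : ∀ ω, f ω ≤ g ω) : expect p f ≤ expect p g :=
  Finset.sum_le_sum fun ω _ => mul_le_mul_of_nonneg_left (h ω) (weight_nonneg h0 h1 ω)

lemma expect_nonneg {p : E → ℝ} (h0 : ∀ e, 0 ≤ p e) (h1 : ∀ e, p e ≤ 1) {f : Finset E → ℝ}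
    (h : ∀ ω, 0 ≤ f ω) : 0 ≤ expect p f :=
  Finset.sum_nonneg fun ω _ => mul_nonneg (weight_nonneg h0 h1 ω) (h ω)

lemma expect_sub (p : E → ℝ) (f g : Finset E → ℝ) :
    expect p (fun ω => f ω - g ω) = expect p f - expect p g := by
  simp [expect, mul_sub]

lemma expect_sum {ι : Type*} (p : E → ℝ) (J : Finset ι) (f : ι → Finset E → ℝ) :
    expect p (fun ω => ∑ i ∈ J, f i ω) = ∑ i ∈ J, expect p (f i) := by
  simp only [expect, Finset.mul_sum]
  exact Finset.sum_comm

lemma expect_one (p : E → ℝ) : expect p (fun _ => 1) = 1 := by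
  have h := Finset.prod_add p (fun e => 1 - p e) Finset.univ
  simp only [add_sub_cancel, Finset.prod_const_one, Finset.powerset_univ] at h
  refine Eq.trans ?_ h.symm
  refine Finset.sum_congr rfl fun ω _ => ?_
  rw [mul_one, weight, Finset.prod_ite]
  congr 1 <;> refine Finset.prod_congr ?_ fun _ _ => rfl <;> ext <;> simp

/-- Cross-multiplied, so that `p e = 1` needs no separate treatment. -/
lemma weight_insert (p : E → ℝ) {e : E} {ω : Finset E} (he : e ∉ ω) :
    weight p (insert e ω) * (1 - p e) = p e * weight p ω := by
  rw [weight, weight, ← Finset.mul_prod_erase _ _ (Finset.mem_univ e),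
    ← Finset.mul_prod_erase _ (fun x => if x ∈ ω then p x else 1 - p x) (Finset.mem_univ e)]
  have : ∏ x ∈ Finset.univ.erase e, (if x ∈ insert e ω then p x else 1 - p x)
      = ∏ x ∈ Finset.univ.erase e, (if x ∈ ω then p x else 1 - p x) :=
    Finset.prod_congr rfl fun x hx => by
      simp [Finset.ne_of_mem_erase hx]
  rw [this]
  simp [he]
  ring

lemma weight_insert_add (p : E → ℝ) {e : E} {ω : Finset E} (he : e ∉ ω) :
    weight p (insert e ω) = p e * (weight p ω + weight p (insert e ω)) := by
  linarith [weight_insert p he]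

lemma expect_eq_sum_erase (p : E → ℝ) (e : E) (f : Finset E → ℝ) :
    expect p f = ∑ ω ∈ (Finset.univ.erase e).powerset,
      (weight p ω * f ω + weight p (insert e ω) * f (insert e ω)) := by
  have h : (Finset.univ : Finset (Finset E)) = (insert e (Finset.univ.erase e)).powerset := by
    rw [Finset.insert_erase (Finset.mem_univ e), Finset.powerset_univ]
  rw [expect, h, Finset.sum_powerset_insert (Finset.notMem_erase e _), ← Finset.sum_add_distrib]

lemma expect_mem (p : E → ℝ) (e : E) (f : Finset E → ℝ) :
    expect p (fun ω => if e ∈ ω then f ω else 0) = p e * expect p (fun ω => f (insert e ω)) := by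
  rw [expect_eq_sum_erase p e, expect_eq_sum_erase p e, Finset.mul_sum]
  refine Finset.sum_congr rfl fun ω hω => ?_
  have he : e ∉ ω := fun h => by simpa using Finset.mem_powerset.1 hω h
  simp only [he, if_false, Finset.mem_insert_self, if_true, Finset.insert_idem]
  linear_combination f (insert e ω) * weight_insert_add p he

/-- Conditioning on `T ⊆ ω` leaves the other coordinates independent, so it amounts to forcing `T`
into the sample. Both correlation inequalities and independence below are read off from this
identity. -/
lemma expect_subset (p : E → ℝ) (T : Finset E) (f : Finset E → ℝ) :
    expect p (fun ω => if T ⊆ ω then f ω else 0)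
      = (∏ e ∈ T, p e) * expect p (fun ω => f (ω ∪ T)) := by
  induction T using Finset.induction_on generalizing f with
  | empty => simp
  | insert e T he ih =>
    have h : ∀ ω, (if insert e T ⊆ ω then f ω else 0)
        = if e ∈ ω then (if T ⊆ ω then f ω else 0) else 0 := fun ω => by
      simp only [Finset.insert_subset_iff]
      split_ifs <;> tauto
    simp only [h]
    rw [expect_mem p e (fun ω => if T ⊆ ω then f ω else 0), Finset.prod_insert he, mul_assoc]
    congr 1
    simp only [Finset.subset_insert_iff_of_notMem he]
    rw [ih (fun ω => f (insert e ω))]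
    simp [Finset.union_insert]

lemma expect_subset_le {p : E → ℝ} (h0 : ∀ e, 0 ≤ p e) (h1 : ∀ e, p e ≤ 1) (T : Finset E)
    {f : Finset E → ℝ} (hf : Antitone f) :
    expect p (fun ω => if T ⊆ ω then f ω else 0) ≤ (∏ e ∈ T, p e) * expect p f := by
  rw [expect_subset]
  exact mul_le_mul_of_nonneg_left (expect_mono h0 h1 fun ω => hf Finset.subset_union_left)
    (Finset.prod_nonneg fun e _ => h0 e)

lemma expect_subset_of_forall_union {p : E → ℝ} (T : Finset E) {f : Finset E → ℝ}
    (hf : ∀ ω, f (ω ∪ T) = f ω) :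
    expect p (fun ω => if T ⊆ ω then f ω else 0) = (∏ e ∈ T, p e) * expect p f := by
  simp [expect_subset, hf]

/-- The expectation is affine in the single parameter `p e`, with slope a weighted sum of `f (insert
e ω) - f ω ≤ 0`. -/
lemma expect_update_le {p : E → ℝ} (h0 : ∀ e, 0 ≤ p e) (h1 : ∀ e, p e ≤ 1)
    {f : Finset E → ℝ} (hf : Antitone f) (e : E) {t : ℝ} (ht : p e ≤ t) :
    expect (Function.update p e t) f ≤ expect p f := by
  rw [expect_eq_sum_erase p e, expect_eq_sum_erase _ e]
  refine Finset.sum_le_sum fun ω hω => ?_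
  have he : e ∉ ω := fun h => by simpa using Finset.mem_powerset.1 hω h
  have key : ∀ q : E → ℝ, (∀ x, x ≠ e → q x = p x) →
      weight q ω = (1 - q e) * ∏ x ∈ Finset.univ.erase e, (if x ∈ ω then p x else 1 - p x) ∧
      weight q (insert e ω)
        = q e * ∏ x ∈ Finset.univ.erase e, (if x ∈ ω then p x else 1 - p x) := fun q hq => by
    rw [weight, weight, ← Finset.mul_prod_erase _ _ (Finset.mem_univ e),
      ← Finset.mul_prod_erase _ (fun x => if x ∈ insert e ω then q x else 1 - q x)
        (Finset.mem_univ e)]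
    constructor
    · rw [if_neg he]
      congr 1
      exact Finset.prod_congr rfl fun x hx => by rw [hq x (Finset.ne_of_mem_erase hx)]
    · rw [if_pos (Finset.mem_insert_self _ _)]
      congr 1
      exact Finset.prod_congr rfl fun x hx => by
        simp [Finset.ne_of_mem_erase hx, hq x (Finset.ne_of_mem_erase hx)]
  obtain ⟨a1, a2⟩ := key p fun _ _ => rfl
  obtain ⟨b1, b2⟩ := key (Function.update p e t) fun x hx => by simp [hx]
  have hW : 0 ≤ ∏ x ∈ Finset.univ.erase e, (if x ∈ ω then p x else 1 - p x) :=
    Finset.prod_nonneg fun x _ => by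
      split_ifs
      · exact h0 x
      · linarith [h1 x]
  rw [a1, a2, b1, b2, Function.update_self]
  have h2 : f (insert e ω) ≤ f ω := hf (Finset.subset_insert e ω)
  nlinarith [mul_nonneg (mul_nonneg hW (sub_nonneg.2 h2)) (sub_nonneg.2 ht)]

lemma expect_antitone {p q : E → ℝ} (h0 : ∀ e, 0 ≤ p e) (hpq : ∀ e, p e ≤ q e)
    (h1 : ∀ e, q e ≤ 1) {f : Finset E → ℝ} (hf : Antitone f) : expect q f ≤ expect p f := by
  have key : ∀ S : Finset E, expect (S.piecewise q p) f ≤ expect p f := fun S => by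
    induction S using Finset.induction_on with
    | empty => simp
    | insert e S he ih =>
      rw [Finset.piecewise_insert]
      refine le_trans (expect_update_le (fun x => ?_) (fun x => ?_) hf e ?_) ih
      · by_cases hx : x ∈ S
        · simpa [hx] using (h0 x).trans (hpq x)
        · simpa [hx] using h0 x
      · by_cases hx : x ∈ S
        · simpa [hx] using h1 x
        · simpa [hx] using (hpq x).trans (h1 x)
      · simpa [he] using hpq e
  simpa using key Finset.univ

/-! ### Correlation inequality, Janson's inequality, second moment. -/

section Avoids

variable {ι : Type*} {T : ι → Finset E} {J : Finset ι}

/-- The probability of avoiding all `T i` is at least the product of the separate probabilities. -/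
lemma prod_one_sub_le_expect_avoids {p : E → ℝ} (h0 : ∀ e, 0 ≤ p e) (h1 : ∀ e, p e ≤ 1) :
    ∏ i ∈ J, (1 - ∏ e ∈ T i, p e) ≤ expect p (avoids T J) := by
  classical
  induction J using Finset.induction_on with
  | empty => simp [expect_one]
  | insert i J hi ih =>
    have h := expect_subset_le h0 h1 (T i) (avoids_antitone (T := T) (J := J))
    have h2 : expect p (avoids T (insert i J)) = expect p (avoids T J)
        - expect p (fun ω => if T i ⊆ ω then avoids T J ω else 0) := by
      rw [← expect_sub]; congr 1; funext ω; exact avoids_insert hi ω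
    have h3 : ∏ e ∈ T i, p e ≤ 1 := Finset.prod_le_one (fun e _ => h0 e) fun e _ => h1 e
    rw [Finset.prod_insert hi, h2]
    nlinarith [mul_le_mul_of_nonneg_left ih (sub_nonneg.2 h3)]

/-- Janson's inequality. -/
lemma expect_avoids_le_exp [DecidableEq ι] {p : E → ℝ} (h0 : ∀ e, 0 ≤ p e) (h1 : ∀ e, p e ≤ 1) :
    expect p (avoids T J) ≤ Real.exp (-∑ i ∈ J, ∏ e ∈ T i, p e
      + ∑ i ∈ J, ∑ j ∈ J with j ≠ i ∧ ¬ Disjoint (T j) (T i), ∏ e ∈ T i ∪ T j, p e) := by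
  induction J using Finset.induction_on with
  | empty => simp [expect_one]
  | insert i J hi ih =>
    have hpos : ∀ S : Finset E, 0 ≤ ∏ e ∈ S, p e := fun S => Finset.prod_nonneg fun e _ => h0 e
    -- `D` collects the sets that interact with `T i`, `F` those independent of it. On `T i ⊆ ω`,
    -- the loss from also avoiding `D` is bounded by a union bound, each of its terms by negative
    -- correlation with avoiding `F`.
    set D := J.filter fun j => ¬ Disjoint (T j) (T i) with hD
    set F := J.filter fun j => Disjoint (T j) (T i) with hF
    set d := ∑ j ∈ D, ∏ e ∈ T i ∪ T j, p e with hd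
    set g := expect p (avoids T J) with hg
    have hg0 : 0 ≤ g := expect_nonneg h0 h1 fun ω => avoids_nonneg ω
    have h2 : expect p (avoids T (insert i J)) = g
        - expect p (fun ω => if T i ⊆ ω then avoids T J ω else 0) := by
      rw [hg, ← expect_sub]; congr 1; funext ω; exact avoids_insert hi ω
    have hmul : ∀ ω, avoids T J ω = avoids T F ω * avoids T D ω := fun ω =>
      (Finset.prod_filter_mul_prod_filter_not J _ _).symm
    have hgF : g ≤ expect p (avoids T F) := expect_mono h0 h1 fun ω => by
      rw [hmul]
      exact mul_le_of_le_one_right (avoids_nonneg ω) (avoids_le_one ω)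
    have h3 : ((∏ e ∈ T i, p e) - d) * expect p (avoids T F)
        ≤ expect p (fun ω => if T i ⊆ ω then avoids T J ω else 0) := by
      have e1 : (∏ e ∈ T i, p e) * expect p (avoids T F)
          = expect p (fun ω => if T i ⊆ ω then avoids T F ω else 0) :=
        (expect_subset_of_forall_union (T i) fun ω =>
          avoids_union_eq (fun j hj => (Finset.mem_filter.1 hj).2) ω).symm
      have e2 : expect p (fun ω => ∑ j ∈ D, if T i ∪ T j ⊆ ω then avoids T F ω else 0)
          ≤ d * expect p (avoids T F) := by
        rw [expect_sum, hd, Finset.sum_mul]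
        exact Finset.sum_le_sum fun j _ => expect_subset_le h0 h1 _ avoids_antitone
      have e3 : expect p (fun ω => (if T i ⊆ ω then avoids T F ω else 0)
          - ∑ j ∈ D, if T i ∪ T j ⊆ ω then avoids T F ω else 0)
          ≤ expect p (fun ω => if T i ⊆ ω then avoids T J ω else 0) :=
        expect_mono h0 h1 fun ω => by
          by_cases hT : T i ⊆ ω
          · simp only [hT, if_true, Finset.union_subset_iff, true_and, hmul]
            have := mul_le_mul_of_nonneg_left (one_sub_sum_le_avoids (T := T) (J := D) ω)
              (avoids_nonneg (T := T) (J := F) ω)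
            simp only [mul_sub, mul_one, Finset.mul_sum, mul_ite, mul_zero] at this
            exact this
          · simp [hT, Finset.union_subset_iff]
      rw [expect_sub] at e3
      linarith
    have h4 : expect p (avoids T (insert i J)) ≤ g * (1 - ((∏ e ∈ T i, p e) - d)) := by
      rw [h2]
      -- Passing from `avoids T F` to the smaller `g` needs a nonnegative coefficient; otherwise the
      -- claimed factor is at least `1` and monotonicity suffices.
      by_cases hc : 0 ≤ (∏ e ∈ T i, p e) - d
      · nlinarith [mul_le_mul_of_nonneg_left hgF hc]
      · have : 0 ≤ expect p (fun ω => if T i ⊆ ω then avoids T J ω else 0) :=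
          expect_nonneg h0 h1 fun ω => by
            split_ifs
            · exact avoids_nonneg ω
            · exact le_rfl
        push Not at hc
        nlinarith
    have h5 : 1 - ((∏ e ∈ T i, p e) - d) ≤ Real.exp (-(∏ e ∈ T i, p e) + d) := by
      linarith [Real.add_one_le_exp (-(∏ e ∈ T i, p e) + d)]
    refine h4.trans ((mul_le_mul_of_nonneg_left h5 hg0).trans
      ((mul_le_mul_of_nonneg_right ih (Real.exp_pos _).le).trans ?_))
    rw [← Real.exp_add]
    refine Real.exp_le_exp.2 ?_
    rw [Finset.sum_insert hi, Finset.sum_insert hi]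
    have h6 : d ≤ ∑ j ∈ insert i J with j ≠ i ∧ ¬ Disjoint (T j) (T i), ∏ e ∈ T i ∪ T j, p e := by
      refine Finset.sum_le_sum_of_subset_of_nonneg (fun j hj => ?_) fun j _ _ => hpos _
      obtain ⟨a, b⟩ := Finset.mem_filter.1 hj
      exact Finset.mem_filter.2 ⟨Finset.mem_insert_of_mem a, fun h => hi (h ▸ a), b⟩
    have h7 : ∑ l ∈ J, ∑ j ∈ J with j ≠ l ∧ ¬ Disjoint (T j) (T l), ∏ e ∈ T l ∪ T j, p e
        ≤ ∑ l ∈ J, ∑ j ∈ insert i J with j ≠ l ∧ ¬ Disjoint (T j) (T l), ∏ e ∈ T l ∪ T j, p e :=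
      Finset.sum_le_sum fun l _ => Finset.sum_le_sum_of_subset_of_nonneg
        (Finset.filter_subset_filter _ (Finset.subset_insert i J)) fun j _ _ => hpos _
    linarith

end Avoids

/-- The second moment method. -/
lemma sq_expect_le {p : E → ℝ} (h0 : ∀ e, 0 ≤ p e) (h1 : ∀ e, p e ≤ 1) (X : Finset E → ℝ)
    [DecidablePred fun ω => X ω ≠ 0] :
    expect p X ^ 2 ≤ expect p (fun ω => if X ω ≠ 0 then 1 else 0) * expect p fun ω => X ω ^ 2 := by
  -- Cauchy–Schwarz for the indicator of `X ≠ 0` and `X`, with the weight split into two square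
  -- roots.
  have h := Finset.sum_mul_sq_le_sq_mul_sq Finset.univ
    (fun ω => √(weight p ω) * if X ω ≠ 0 then 1 else 0) (fun ω => √(weight p ω) * X ω)
  have hs : ∀ ω, √(weight p ω) ^ 2 = weight p ω := fun ω => Real.sq_sqrt (weight_nonneg h0 h1 ω)
  have e1 : ∀ ω, (√(weight p ω) * if X ω ≠ 0 then 1 else 0) * (√(weight p ω) * X ω)
      = weight p ω * X ω := fun ω => by
    by_cases hX : X ω = 0
    · simp [hX]
    · simp only [hX, ne_eq, not_false_eq_true, if_true]
      linear_combination X ω * hs ω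
  have e2 : ∀ ω, (√(weight p ω) * if X ω ≠ 0 then 1 else 0) ^ 2
      = weight p ω * if X ω ≠ 0 then 1 else 0 := fun ω => by
    rw [mul_pow, hs]
    by_cases hX : X ω = 0 <;> simp [hX]
  simp only [e1, e2, mul_pow _ (X _), hs] at h
  exact h

end RandomSubset

namespace RandomGraph

open RandomSubset

/-! ### The random graph as a random set of pairs. -/

section Bridge

/-- The probability of presence of a vertex set as an edge: `p` for pairs, `0` otherwise. -/
noncomputable def pairProb {V : Type*} (p : ℝ) (a : Finset V) : ℝ := if a.card = 2 then p else 0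

lemma pairProb_nonneg {V : Type*} {p : ℝ} (hp : 0 ≤ p) (a : Finset V) : 0 ≤ pairProb p a := by
  unfold pairProb; split_ifs <;> simp [hp]

lemma pairProb_le_one {V : Type*} {p : ℝ} (hp : p ≤ 1) (a : Finset V) : pairProb p a ≤ 1 := by
  unfold pairProb; split_ifs <;> simp [hp]

lemma prod_pairProb_eq_pow {V : Type*} {p : ℝ} {U : Finset (Finset V)} (hU : ∀ a ∈ U, a.card = 2) :
    ∏ a ∈ U, pairProb p a = p ^ U.card := by
  rw [← Finset.prod_const]
  exact Finset.prod_congr rfl fun a ha => if_pos (hU a ha)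

instance {V : Type*} [Countable V] : MeasurableSingletonClass (SimpleGraph V) := ⟨fun G => by
  rw [show ({G} : Set (SimpleGraph V)) = SimpleGraph.edgeSet ⁻¹' {G.edgeSet} by ext; simp]
  exact SimpleGraph.measurableEmbedding_edgeSet.measurable (MeasurableSet.singleton _)⟩

lemma binomialRandom_real_not {V : Type*} [Finite V] (p : unitInterval) (P : SimpleGraph V → Prop) :
    (SimpleGraph.binomialRandom V p).real {G | ¬ P G}
      = 1 - (SimpleGraph.binomialRandom V p).real {G | P G} :=
  MeasureTheory.probReal_compl_eq_one_sub (Set.toFinite {G | P G}).measurableSet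

variable {V : Type*} [Fintype V] [DecidableEq V]

/-- The graph whose edges are the pairs in `ω`. -/
def ofPairs (ω : Finset (Finset V)) : SimpleGraph V where
  Adj u v := u ≠ v ∧ {u, v} ∈ ω
  symm := ⟨fun u v h => ⟨h.1.symm, by rw [Finset.pair_comm]; exact h.2⟩⟩
  loopless := ⟨fun _ h => h.1 rfl⟩

/-- The edges of a graph as vertex pairs. -/
noncomputable def pairs (G : SimpleGraph V) : Finset (Finset V) :=
  (Set.toFinite ((fun e : Sym2 V => e.toFinset) '' G.edgeSet)).toFinset

lemma mem_pairs_iff {G : SimpleGraph V} {a : Finset V} :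
    a ∈ pairs G ↔ ∃ u v, G.Adj u v ∧ a = {u, v} := by
  simp only [pairs, Set.Finite.mem_toFinset, Set.mem_image]
  constructor
  · rintro ⟨e, he, rfl⟩
    induction e with | _ u v => exact ⟨u, v, by simpa using he, by ext; simp⟩
  · rintro ⟨u, v, h, rfl⟩
    exact ⟨s(u, v), by simpa using h, by ext; simp⟩

lemma card_pairs (G : SimpleGraph V) : (pairs G).card = G.edgeSet.ncard := by
  rw [pairs, ← Set.ncard_eq_toFinset_card]
  refine Set.InjOn.ncard_image fun e _ e' _ h => ?_
  refine SetLike.ext fun x => ?_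
  have := congrArg (x ∈ ·) h
  simpa [Sym2.mem_toFinset] using this

lemma pairs_subset (G : SimpleGraph V) : pairs G ⊆ Finset.univ.powersetCard 2 := fun a ha => by
  obtain ⟨u, v, h, rfl⟩ := mem_pairs_iff.1 ha
  exact Finset.mem_powersetCard.2 ⟨Finset.subset_univ _, Finset.card_pair h.ne⟩

lemma ofPairs_pairs (G : SimpleGraph V) : ofPairs (pairs G) = G := by
  ext u v
  simp only [ofPairs, mem_pairs_iff]
  constructor
  · rintro ⟨hne, a, b, h, hab⟩
    have ha : a ∈ ({u, v} : Finset V) := hab ▸ by simp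
    have hb : b ∈ ({u, v} : Finset V) := hab ▸ by simp
    simp only [Finset.mem_insert, Finset.mem_singleton] at ha hb
    rcases ha with rfl | rfl <;> rcases hb with rfl | rfl
    · exact absurd h (G.irrefl)
    · exact h
    · exact h.symm
    · exact absurd h (G.irrefl)
  · exact fun h => ⟨h.ne, u, v, h, rfl⟩

lemma pairs_ofPairs {ω : Finset (Finset V)} (h : ω ⊆ Finset.univ.powersetCard 2) :
    pairs (ofPairs ω) = ω := by
  ext a
  rw [mem_pairs_iff]
  constructor
  · rintro ⟨u, v, h, rfl⟩
    exact h.2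
  · intro ha
    obtain ⟨u, v, huv, rfl⟩ := Finset.card_eq_two.1 (Finset.mem_powersetCard.1 (h ha)).2
    exact ⟨u, v, ⟨huv, ha⟩, rfl⟩

lemma weight_pairProb_of_subset (p : ℝ) {ω : Finset (Finset V)}
    (h : ω ⊆ Finset.univ.powersetCard 2) :
    weight (pairProb p) ω = p ^ ω.card * (1 - p) ^ ((Fintype.card V).choose 2 - ω.card) := by
  have h1 : weight (pairProb p) ω
      = ∏ a ∈ Finset.univ.powersetCard 2, if a ∈ ω then p else 1 - p := by
    refine Eq.symm (Finset.prod_subset_one_on_sdiff (Finset.subset_univ _) (fun a ha => ?_)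
      fun a ha => ?_)
    · have h2 : a ∉ Finset.univ.powersetCard 2 := (Finset.mem_sdiff.1 ha).2
      rw [if_neg fun hx => h2 (h hx), pairProb, if_neg fun hx => h2 (by simp [hx]), sub_zero]
    · simp [pairProb, (Finset.mem_powersetCard.1 ha).2]
  rw [h1, Finset.prod_ite, Finset.prod_const, Finset.prod_const, Finset.filter_mem_eq_inter,
    Finset.inter_eq_right.2 h, Finset.filter_notMem_eq_sdiff, Finset.card_sdiff_of_subset h,
    Finset.card_powersetCard, Finset.card_univ]

lemma weight_pairProb_of_not_subset (p : ℝ) {ω : Finset (Finset V)}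
    (h : ¬ ω ⊆ Finset.univ.powersetCard 2) : weight (pairProb p) ω = 0 := by
  obtain ⟨a, ha, h2⟩ := Finset.not_subset.1 h
  refine Finset.prod_eq_zero (Finset.mem_univ a) ?_
  rw [if_pos ha, pairProb, if_neg fun hx => h2 (by simp [hx])]

/-- Sets that are not pairs have probability `0`, so only sets of pairs carry weight; on these,
`pairs` and `ofPairs` are inverse bijections that match the two point masses. -/
lemma binomialRandom_real_eq_expect (p : unitInterval) (P : SimpleGraph V → Prop)
    [DecidablePred P] :
    (SimpleGraph.binomialRandom V p).real {G | P G}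
      = expect (pairProb (p : ℝ)) fun ω => if P (ofPairs ω) then 1 else 0 := by
  classical
  have h1 : (SimpleGraph.binomialRandom V p).real {G | P G}
      = ∑ G : SimpleGraph V, if P G then (SimpleGraph.binomialRandom V p).real {G} else 0 := by
    rw [← Finset.sum_filter, MeasureTheory.sum_measureReal_singleton]
    simp
  have h2 : expect (pairProb (p : ℝ)) (fun ω => if P (ofPairs ω) then 1 else 0)
      = ∑ ω ∈ (Finset.univ.powersetCard 2 : Finset (Finset V)).powerset,
        weight (pairProb (p : ℝ)) ω * if P (ofPairs ω) then 1 else 0 := by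
    refine (Finset.sum_subset (Finset.subset_univ _) fun ω _ hω => ?_).symm
    rw [weight_pairProb_of_not_subset _ (by simpa using hω), zero_mul]
  rw [h1, h2]
  refine Finset.sum_bij' (fun G _ => pairs G) (fun ω _ => ofPairs ω)
    (fun G _ => Finset.mem_powerset.2 (pairs_subset G)) (fun _ _ => Finset.mem_univ _)
    (fun G _ => ofPairs_pairs G) (fun ω hω => pairs_ofPairs (Finset.mem_powerset.1 hω))
    fun G _ => ?_
  rw [weight_pairProb_of_subset _ (pairs_subset G), ofPairs_pairs, card_pairs, mul_ite, mul_one,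
    mul_zero, MeasureTheory.measureReal_def, SimpleGraph.binomialRandom_singleton,
    Nat.card_eq_fintype_card]
  simp

end Bridge

/-! ### Overlaps of clique extensions and the Janson bound. -/

section Extensions

variable {V : Type*} [DecidableEq V]

/-- The pairs inside `S ∪ e` other than `e`. -/
def extension (e S : Finset V) : Finset (Finset V) := ((S ∪ e).powersetCard 2).erase e

lemma notMem_extension (e S : Finset V) : e ∉ extension e S := Finset.notMem_erase _ _

lemma card_eq_two_of_mem_extension {e S a : Finset V} (h : a ∈ extension e S) : a.card = 2 :=
  (Finset.mem_powersetCard.1 (Finset.mem_of_mem_erase h)).2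

lemma card_extension {e S : Finset V} (he : e.card = 2) (hS : Disjoint S e) :
    (extension e S).card = (S.card + 2).choose 2 - 1 := by
  rw [extension, Finset.card_erase_of_mem, Finset.card_powersetCard,
    Finset.card_union_of_disjoint hS, he]
  exact Finset.mem_powersetCard.2 ⟨Finset.subset_union_right, he⟩

/-- Let `j = (S ∩ S').card`. If `e = e'` then `j < k` and the common pairs form an extension of `e`
by `j` vertices, `j (j + 3) / 2` of them. If `e ≠ e'` the common vertices number at most `j + 1`,
giving at most `(j + 1) j / 2` pairs. In particular `j = 0` leaves no common pair. -/
lemma two_mul_card_extension_inter_le {k : ℕ} {e e' S S' : Finset V} (he : e.card = 2)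
    (he' : e'.card = 2) (hS : S.card = k) (hS' : S'.card = k) (h1 : Disjoint S (e ∪ e'))
    (h2 : Disjoint S' (e ∪ e')) (hne : (e', S') ≠ (e, S)) :
    2 * (extension e S ∩ extension e' S').card ≤ (k + 2) * (S ∩ S').card := by
  rw [Finset.disjoint_union_right] at h1 h2
  have hsub : (S ∪ e) ∩ (S' ∪ e') ⊆ (S ∩ S') ∪ (e ∩ e') := fun x hx => by
    have a1 : x ∈ S → x ∉ e' := fun h => Finset.disjoint_left.1 h1.2 h
    have a2 : x ∈ S' → x ∉ e := fun h => Finset.disjoint_left.1 h2.1 h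
    simp only [Finset.mem_inter, Finset.mem_union] at hx ⊢
    tauto
  by_cases hee : e = e'
  · subst hee
    have hlt : (S ∩ S').card + 1 ≤ k := by
      rw [Nat.succ_le_iff, ← hS]
      refine Finset.card_lt_card (Finset.ssubset_iff_subset_ne.2 ⟨Finset.inter_subset_left,
        fun h => hne ?_⟩)
      rw [Finset.eq_of_subset_of_card_le (Finset.inter_eq_left.1 h) (by omega)]
    have hle : extension e S ∩ extension e S' ⊆ extension e (S ∩ S') := fun a ha => by
      simp only [extension, Finset.mem_inter, Finset.mem_erase, Finset.mem_powersetCard] at ha ⊢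
      refine ⟨ha.1.1, ?_, ha.1.2.2⟩
      exact (Finset.subset_inter ha.1.2.1 ha.2.2.1).trans (hsub.trans (by simp))
    have hc := Finset.card_le_card hle
    rw [card_extension he (h1.1.mono_left Finset.inter_subset_left)] at hc
    have h4 : 2 * ((S ∩ S').card + 2).choose 2 = ((S ∩ S').card + 2) * ((S ∩ S').card + 1) := by
      rw [Nat.choose_two_right, Nat.mul_div_cancel' (Nat.even_mul_pred_self _).two_dvd]; rfl
    have h5 : 2 * (((S ∩ S').card + 2).choose 2 - 1) = ((S ∩ S').card + 3) * (S ∩ S').card := by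
      rw [Nat.mul_sub, h4]
      exact Nat.sub_eq_of_eq_add (by ring)
    nlinarith
  · have hc : (e ∩ e').card ≤ 1 := by
      by_contra! hlt
      have h3 : e ∩ e' = e := Finset.eq_of_subset_of_card_le Finset.inter_subset_left (by omega)
      exact hee (Finset.eq_of_subset_of_card_le (Finset.inter_eq_left.1 h3) (by omega))
    have hle : extension e S ∩ extension e' S' ⊆ ((S ∩ S') ∪ (e ∩ e')).powersetCard 2 :=
      fun a ha => by
        simp only [extension, Finset.mem_inter, Finset.mem_erase, Finset.mem_powersetCard] at ha ⊢
        exact ⟨(Finset.subset_inter ha.1.2.1 ha.2.2.1).trans hsub, ha.1.2.2⟩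
    have h3 := Finset.card_le_card hle
    rw [Finset.card_powersetCard] at h3
    have h4 : ((S ∩ S') ∪ (e ∩ e')).card ≤ (S ∩ S').card + 1 :=
      (Finset.card_union_le _ _).trans (by omega)
    have h5 := h3.trans (Nat.choose_le_choose 2 h4)
    have h6 : 2 * ((S ∩ S').card + 1).choose 2 = ((S ∩ S').card + 1) * (S ∩ S').card := by
      rw [Nat.choose_two_right, Nat.mul_div_cancel' (Nat.even_mul_pred_self _).two_dvd]; rfl
    have h7 : (S ∩ S').card ≤ k := hS ▸ Finset.card_le_card Finset.inter_subset_left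
    nlinarith

/-- The probability of a union of two overlapping extensions, in terms of a bound `y ^ 2` for the
edge probability. -/
lemma prod_union_extension_le {k : ℕ} {e e' S S' : Finset V} (he : e.card = 2)
    (he' : e'.card = 2) (hS : S.card = k) (hS' : S'.card = k) (h1 : Disjoint S (e ∪ e'))
    (h2 : Disjoint S' (e ∪ e')) (hne : (e', S') ≠ (e, S)) {p y : ℝ} (hp : 0 ≤ p)
    (hpy : p ≤ y ^ 2) (hy0 : 0 < y) (hy1 : y ≤ 1) :
    ∏ a ∈ extension e S ∪ extension e' S', pairProb p a
      ≤ ((y ^ 2) ^ ((k + 2).choose 2 - 1)) ^ 2 / (y ^ (k + 2)) ^ (S ∩ S').card := by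
  have hsh := two_mul_card_extension_inter_le he he' hS hS' h1 h2 hne
  rw [Finset.disjoint_union_right] at h1 h2
  rw [prod_pairProb_eq_pow fun a ha => (Finset.mem_union.1 ha).elim card_eq_two_of_mem_extension
    card_eq_two_of_mem_extension, le_div_iff₀ (by positivity)]
  have hcu := Finset.card_union_add_card_inter (extension e S) (extension e' S')
  rw [card_extension he h1.1, card_extension he' h2.2, hS, hS'] at hcu
  calc p ^ (extension e S ∪ extension e' S').card * (y ^ (k + 2)) ^ (S ∩ S').card
      ≤ (y ^ 2) ^ (extension e S ∪ extension e' S').card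
        * y ^ (2 * (extension e S ∩ extension e' S').card) := by
        rw [← pow_mul]
        exact mul_le_mul (pow_le_pow_left₀ hp hpy _) (pow_le_pow_of_le_one hy0.le hy1 hsh)
          (by positivity) (by positivity)
    _ = _ := by
        rw [pow_mul, ← pow_add, hcu, ← pow_mul, ← pow_mul, ← pow_mul]
        congr 1
        ring

/-- A bound for the weighted number of `k`-sets meeting a given `k`-set. -/
lemma sum_inv_pow_card_inter_le [Fintype V] {k : ℕ} {S : Finset V} (hS : S.card = k)
    {z : ℝ} (hz0 : 0 < z) (hz : 1 ≤ Fintype.card V * z) :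
    ∑ S' ∈ Finset.univ.powersetCard k with (S ∩ S').Nonempty, 1 / z ^ (S ∩ S').card
      ≤ 2 ^ k * ((Fintype.card V : ℝ) ^ k / (Fintype.card V * z)) := by
  have hn : (0 : ℝ) < Fintype.card V := pos_of_mul_pos_left (by linarith) hz0.le
  have hmaps : ∀ S' ∈ (Finset.univ.powersetCard k).filter (fun S' => (S ∩ S').Nonempty),
      S ∩ S' ∈ S.powerset := fun S' _ => Finset.mem_powerset.2 Finset.inter_subset_left
  -- Group by `R = S ∩ S'`, with at most `2 ^ k` choices. For `r = R.card ≥ 1`, at most `n ^ (k -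
  -- r)` sets contain `R`, contributing at most `n ^ k / (n z) ^ r ≤ n ^ k / (n z)`.
  rw [← Finset.sum_fiberwise_of_maps_to hmaps]
  have hcard : ((S.powerset.card : ℕ) : ℝ) = 2 ^ k := by simp [hS]
  rw [← hcard, ← nsmul_eq_mul]
  refine Finset.sum_le_card_nsmul _ _ _ fun R hR => ?_
  by_cases hR0 : R.Nonempty
  · have hRk : R.card ≤ k := hS ▸ Finset.card_le_card (Finset.mem_powerset.1 hR)
    have hcount : (((Finset.univ.powersetCard k).filter (fun S' => (S ∩ S').Nonempty)).filter
        (fun S' => S ∩ S' = R)).card ≤ Fintype.card V ^ (k - R.card) := by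
      refine (Finset.card_le_card_of_injOn (t := Finset.univ.powersetCard (k - R.card))
        (fun S' => S' \ R) (fun S' hS' => ?_) fun A hA B hB hAB => ?_).trans ?_
      · simp only [Finset.coe_filter, Finset.mem_filter, Finset.mem_powersetCard,
          Set.mem_ofPred_eq] at hS'
        have hRS : R ⊆ S' := hS'.2 ▸ Finset.inter_subset_right
        simp [Finset.card_sdiff_of_subset hRS, hS'.1.1.2]
      · simp only [Finset.coe_filter, Finset.mem_filter, Finset.mem_powersetCard,
          Set.mem_ofPred_eq] at hA hB
        have hRA : R ⊆ A := hA.2 ▸ Finset.inter_subset_right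
        have hRB : R ⊆ B := hB.2 ▸ Finset.inter_subset_right
        rw [← Finset.sdiff_union_of_subset hRA, ← Finset.sdiff_union_of_subset hRB]
        exact congrArg (· ∪ R) hAB
      · rw [Finset.card_powersetCard, Finset.card_univ]
        exact Nat.choose_le_pow _ _
    have hterm : ∀ S' ∈ ((Finset.univ.powersetCard k).filter (fun S' => (S ∩ S').Nonempty)).filter
        (fun S' => S ∩ S' = R), 1 / z ^ (S ∩ S').card ≤ 1 / z ^ R.card := fun S' hS' => by
      rw [(Finset.mem_filter.1 hS').2]
    refine (Finset.sum_le_card_nsmul _ _ _ hterm).trans ?_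
    rw [nsmul_eq_mul]
    have hcount' : (((((Finset.univ.powersetCard k).filter (fun S' => (S ∩ S').Nonempty)).filter
        (fun S' => S ∩ S' = R)).card : ℕ) : ℝ) ≤ (Fintype.card V : ℝ) ^ (k - R.card) :=
      mod_cast hcount
    refine (mul_le_mul_of_nonneg_right hcount' (by positivity)).trans ?_
    have h1 : (Fintype.card V * z) ≤ (Fintype.card V * z) ^ R.card :=
      le_self_pow₀ hz hR0.card_pos.ne'
    have h2 : (Fintype.card V : ℝ) ^ (k - R.card) * (1 / z ^ R.card)
        = (Fintype.card V : ℝ) ^ k / (Fintype.card V * z) ^ R.card := by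
      rw [mul_pow, ← Nat.sub_add_cancel hRk, pow_add, Nat.add_sub_cancel]
      field_simp
    rw [h2]
    exact div_le_div_of_nonneg_left (by positivity) (by positivity) h1
  · rw [Finset.sum_eq_zero]
    · positivity
    · intro S' hS'
      rw [Finset.mem_filter, Finset.mem_filter] at hS'
      exact absurd (hS'.2 ▸ hS'.1.2) hR0

/-- The probability that none of the pairs in `F` has an extension by a `k`-set avoiding all of
these pairs. -/
lemma expect_avoids_extension_le [Fintype V] {k : ℕ} {F : Finset (Finset V)}
    (hF : ∀ e ∈ F, e.card = 2) {p y : ℝ} (hp : 0 ≤ p) (hpy : p ≤ y ^ 2) (hy0 : 0 < y)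
    (hy1 : y ≤ 1) (hny : 1 ≤ Fintype.card V * y ^ (k + 2)) :
    expect (pairProb p) (avoids (fun i : Finset V × Finset V => extension i.1 i.2)
        (F ×ˢ (Finset.univ \ F.biUnion id).powersetCard k))
      ≤ Real.exp (-(F.card * (Fintype.card V - 2 * F.card).choose k
            * p ^ ((k + 2).choose 2 - 1))
          + (F.card : ℝ) ^ 2 * 2 ^ k
            * (((Fintype.card V : ℝ) ^ k * (y ^ 2) ^ ((k + 2).choose 2 - 1)) ^ 2
              / (Fintype.card V * y ^ (k + 2)))) := by
  set n := Fintype.card V with hn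
  set m := (k + 2).choose 2 - 1 with hm
  set A := (Finset.univ \ F.biUnion id).powersetCard k with hA
  have hp1 : p ≤ 1 := hpy.trans (pow_le_one₀ hy0.le hy1)
  have hn0 : (0 : ℝ) < n := pos_of_mul_pos_left (by linarith) (by positivity : 0 ≤ y ^ (k + 2))
  have hmem : ∀ {S e}, S ∈ A → e ∈ F → Disjoint S e := fun {S e} hS he => by
    have h1 := (Finset.mem_powersetCard.1 hS).1
    refine Finset.disjoint_left.2 fun x hx hxe => ?_
    exact (Finset.mem_sdiff.1 (h1 hx)).2 (Finset.mem_biUnion.2 ⟨e, he, hxe⟩)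
  have hcardA : ∀ {S}, S ∈ A → S.card = k := fun hS => (Finset.mem_powersetCard.1 hS).2
  refine (expect_avoids_le_exp (pairProb_nonneg hp) (pairProb_le_one hp1)).trans
    (Real.exp_le_exp.2 (add_le_add (neg_le_neg ?_) ?_))
  · have h1 : ∀ i ∈ F ×ˢ A, ∏ a ∈ extension i.1 i.2, pairProb p a = p ^ m := fun i hi => by
      obtain ⟨he, hS⟩ := Finset.mem_product.1 hi
      rw [prod_pairProb_eq_pow fun a => card_eq_two_of_mem_extension,
        card_extension (hF _ he) (hmem hS he), hcardA hS]
    rw [Finset.sum_congr rfl h1, Finset.sum_const, Finset.card_product, nsmul_eq_mul]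
    push_cast
    refine mul_le_mul_of_nonneg_right (mul_le_mul_of_nonneg_left ?_ (Nat.cast_nonneg _))
      (by positivity)
    rw [hA, Finset.card_powersetCard]
    refine Nat.cast_le.2 (Nat.choose_le_choose k ?_)
    rw [Finset.card_univ_sdiff]
    refine Nat.sub_le_sub_left ?_ _
    rw [mul_comm]
    exact Finset.card_biUnion_le_card_mul _ _ _ fun e he => (hF e he).le
  · have hinner : ∀ i ∈ F ×ˢ A, ∑ j ∈ F ×ˢ A with j ≠ i ∧
        ¬ Disjoint (extension j.1 j.2) (extension i.1 i.2),
        ∏ a ∈ extension i.1 i.2 ∪ extension j.1 j.2, pairProb p a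
        ≤ F.card * (((y ^ 2) ^ m) ^ 2 * (2 ^ k * ((n : ℝ) ^ k / (n * y ^ (k + 2))))) := by
      rintro ⟨e, S⟩ hi
      obtain ⟨he, hS⟩ := Finset.mem_product.1 hi
      have hsum : ∑ j ∈ F ×ˢ (Finset.univ.powersetCard k).filter (fun S' => (S ∩ S').Nonempty),
          ((y ^ 2) ^ m) ^ 2 * (1 / (y ^ (k + 2)) ^ (S ∩ j.2).card)
          ≤ F.card * (((y ^ 2) ^ m) ^ 2 * (2 ^ k * ((n : ℝ) ^ k / (n * y ^ (k + 2))))) := by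
        rw [Finset.sum_product]
        simp only []
        rw [Finset.sum_const, nsmul_eq_mul, ← Finset.mul_sum]
        gcongr
        exact sum_inv_pow_card_inter_le (hcardA hS) (by positivity) hny
      refine le_trans ?_ hsum
      have hbound : ∀ j ∈ (F ×ˢ A).filter (fun j => j ≠ (e, S) ∧
          ¬ Disjoint (extension j.1 j.2) (extension e S)),
          j ∈ F ×ˢ (Finset.univ.powersetCard k).filter (fun S' => (S ∩ S').Nonempty) ∧
          ∏ a ∈ extension e S ∪ extension j.1 j.2, pairProb p a
          ≤ ((y ^ 2) ^ m) ^ 2 * (1 / (y ^ (k + 2)) ^ (S ∩ j.2).card) := by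
        rintro ⟨e', S'⟩ hj
        rw [Finset.mem_filter] at hj
        obtain ⟨hj, hne, hnd⟩ := hj
        obtain ⟨he', hS'⟩ := Finset.mem_product.1 hj
        have d1 : Disjoint S (e ∪ e') :=
          Finset.disjoint_union_right.2 ⟨hmem hS he, hmem hS he'⟩
        have d2 : Disjoint S' (e ∪ e') :=
          Finset.disjoint_union_right.2 ⟨hmem hS' he, hmem hS' he'⟩
        refine ⟨?_, ?_⟩
        · refine Finset.mem_product.2 ⟨he', Finset.mem_filter.2 ⟨?_, ?_⟩⟩
          · exact Finset.mem_powersetCard.2 ⟨Finset.subset_univ _, hcardA hS'⟩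
          · by_contra h0
            have h2 := two_mul_card_extension_inter_le (hF _ he) (hF _ he') (hcardA hS)
              (hcardA hS') d1 d2 hne
            rw [Finset.not_nonempty_iff_eq_empty.1 h0, Finset.card_empty, mul_zero] at h2
            refine hnd (Finset.disjoint_iff_inter_eq_empty.2 ?_)
            rw [Finset.inter_comm, ← Finset.card_eq_zero]
            simpa using h2
        · rw [mul_one_div]
          exact prod_union_extension_le (hF _ he) (hF _ he') (hcardA hS) (hcardA hS') d1 d2 hne
            hp hpy hy0 hy1
      refine (Finset.sum_le_sum fun j hj => (hbound j hj).2).trans ?_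
      exact Finset.sum_le_sum_of_subset_of_nonneg (fun j hj => (hbound j hj).1)
        fun j _ _ => by positivity
    refine (Finset.sum_le_card_nsmul _ _ _ hinner).trans ?_
    have hcA : ((A.card : ℕ) : ℝ) ≤ (n : ℝ) ^ k := by
      rw [hA, Finset.card_powersetCard]
      exact_mod_cast (Nat.choose_le_pow _ _).trans (Nat.pow_le_pow_left (Finset.card_le_univ _) k)
    rw [nsmul_eq_mul, Finset.card_product, Nat.cast_mul]
    calc (F.card * A.card : ℝ)
          * (F.card * (((y ^ 2) ^ m) ^ 2 * (2 ^ k * ((n : ℝ) ^ k / (n * y ^ (k + 2))))))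
        ≤ (F.card * (n : ℝ) ^ k)
          * (F.card * (((y ^ 2) ^ m) ^ 2 * (2 ^ k * ((n : ℝ) ^ k / (n * y ^ (k + 2)))))) := by
          gcongr
      _ = _ := by ring

end Extensions

end RandomGraph

namespace RandomGraph

open RandomSubset

/-! ### First and second moment of the number of bad edges. -/

section Moments

variable {V : Type*} [Fintype V] [DecidableEq V]

/-- The indicator of the event that no `k`-set extends the pair `e` to a clique. -/
noncomputable def inextensible (k : ℕ) (e : Finset V) (ω : Finset (Finset V)) : ℝ :=
  avoids (extension e) ((Finset.univ \ e).powersetCard k) ω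

/-- The indicator of the event that the pair `e` is an edge that no `k`-set extends to a clique. -/
noncomputable def isolatedEdge (k : ℕ) (e : Finset V) (ω : Finset (Finset V)) : ℝ :=
  if {e} ⊆ ω then inextensible k e ω else 0

/-- The number of edges that no `k`-set extends to a clique. -/
noncomputable def isolatedEdges (k : ℕ) (ω : Finset (Finset V)) : ℝ :=
  ∑ e ∈ Finset.univ.powersetCard 2, isolatedEdge k e ω

lemma inextensible_eq_one_or_zero (k : ℕ) (e : Finset V) (ω : Finset (Finset V)) :
    inextensible k e ω = 1 ∧ (∀ S ∈ (Finset.univ \ e).powersetCard k, ¬ extension e S ⊆ ω) ∨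
    inextensible k e ω = 0 ∧ (∃ S ∈ (Finset.univ \ e).powersetCard k, extension e S ⊆ ω) := by
  classical
  rw [inextensible, avoids_eq_ite]
  by_cases h : ∀ S ∈ (Finset.univ \ e).powersetCard k, ¬ extension e S ⊆ ω
  · exact Or.inl ⟨if_pos h, h⟩
  · refine Or.inr ⟨if_neg h, ?_⟩
    push Not at h
    exact h

lemma isolatedEdge_nonneg (k : ℕ) (e : Finset V) (ω : Finset (Finset V)) :
    0 ≤ isolatedEdge k e ω := by
  unfold isolatedEdge inextensible
  split_ifs
  · exact avoids_nonneg ω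
  · exact le_rfl

/-- A clique `K` through `e` corresponds to `S = K \ e`; the pair `e` itself is already present,
which is why `extension` omits it. -/
lemma everyEdgeInClique_ofPairs_iff {k : ℕ} {ω : Finset (Finset V)} :
    EveryEdgeInClique (k + 2) (ofPairs ω) ↔ ∀ e ∈ ω, e.card = 2 →
      ∃ S ∈ (Finset.univ \ e).powersetCard k, extension e S ⊆ ω := by
  constructor
  · intro h e he hc
    obtain ⟨u, v, huv, rfl⟩ := Finset.card_eq_two.1 hc
    obtain ⟨K, hK, hu, hv⟩ := h u v ⟨huv, he⟩
    have hsub : {u, v} ⊆ K := Finset.insert_subset hu (Finset.singleton_subset_iff.2 hv)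
    refine ⟨K \ {u, v}, Finset.mem_powersetCard.2 ⟨Finset.sdiff_subset_sdiff
      (Finset.subset_univ _) subset_rfl, ?_⟩, fun a ha => ?_⟩
    · rw [Finset.card_sdiff_of_subset hsub, hc, hK.card_eq]; rfl
    · rw [extension, Finset.sdiff_union_of_subset hsub, Finset.mem_erase,
        Finset.mem_powersetCard] at ha
      obtain ⟨x, y, hxy, rfl⟩ := Finset.card_eq_two.1 ha.2.2
      exact (hK.isClique (ha.2.1 (by simp)) (ha.2.1 (by simp)) hxy).2
  · intro h u v huv
    have hc : ({u, v} : Finset V).card = 2 := Finset.card_pair huv.1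
    obtain ⟨S, hS, hext⟩ := h {u, v} huv.2 hc
    obtain ⟨hS1, hS2⟩ := Finset.mem_powersetCard.1 hS
    have hd : Disjoint S {u, v} := (Finset.subset_sdiff.1 hS1).2
    refine ⟨S ∪ {u, v}, ⟨fun x hx y hy hxy => ⟨hxy, ?_⟩, ?_⟩, by simp, by simp⟩
    · by_cases heq : ({x, y} : Finset V) = {u, v}
      · rw [heq]; exact huv.2
      · refine hext (Finset.mem_erase.2 ⟨heq, Finset.mem_powersetCard.2 ⟨?_, Finset.card_pair hxy⟩⟩)
        exact Finset.insert_subset (by simpa using hx) (Finset.singleton_subset_iff.2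
          (by simpa using hy))
    · rw [Finset.card_union_of_disjoint hd, hS2, hc]

lemma isolatedEdges_nonneg (k : ℕ) (ω : Finset (Finset V)) : 0 ≤ isolatedEdges k ω :=
  Finset.sum_nonneg fun e _ => isolatedEdge_nonneg k e ω

lemma not_everyEdgeInClique_iff {k : ℕ} {ω : Finset (Finset V)} :
    ¬ EveryEdgeInClique (k + 2) (ofPairs ω) ↔
      ∃ e ∈ Finset.univ.powersetCard 2, isolatedEdge k e ω = 1 := by
  rw [everyEdgeInClique_ofPairs_iff]
  push Not
  refine exists_congr fun e => ?_
  rw [isolatedEdge]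
  rcases inextensible_eq_one_or_zero k e ω with ⟨h1, h2⟩ | ⟨h1, S, h2, h3⟩
  · rw [h1]
    by_cases he : e ∈ ω
    · simp only [he, true_and, Finset.singleton_subset_iff, if_true, Finset.mem_powersetCard,
        Finset.subset_univ, and_true]
      exact and_iff_left fun S hS => h2 S (Finset.mem_powersetCard.2 hS)
    · simp [he]
  · rw [h1]
    simp only [ite_self, zero_ne_one, and_false, iff_false, not_and]
    exact fun _ _ h => h S h2 h3

lemma isolatedEdges_ne_zero_iff {k : ℕ} {ω : Finset (Finset V)} :
    isolatedEdges k ω ≠ 0 ↔ ¬ EveryEdgeInClique (k + 2) (ofPairs ω) := by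
  rw [not_everyEdgeInClique_iff, isolatedEdges, ne_eq,
    Finset.sum_eq_zero_iff_of_nonneg fun e _ => isolatedEdge_nonneg k e ω]
  push Not
  refine exists_congr fun e => and_congr_right fun _ => ?_
  rw [isolatedEdge]
  rcases inextensible_eq_one_or_zero k e ω with ⟨h1, h2⟩ | ⟨h1, h2⟩ <;> rw [h1] <;> simp

/-- No extension of `e` uses the pair `e`, so its presence is independent of having no extension. -/
lemma expect_isolatedEdge (k : ℕ) {e : Finset V} (he : e.card = 2) (p : ℝ) :
    expect (pairProb p) (isolatedEdge k e) = p * expect (pairProb p) (inextensible k e) := by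
  have h := expect_subset_of_forall_union (p := pairProb p) {e} (f := inextensible k e)
    (avoids_union_eq fun S _ => Finset.disjoint_singleton_right.2 (notMem_extension e S))
  rw [prod_pairProb_eq_pow (by simpa using he), Finset.card_singleton, pow_one] at h
  exact h

lemma sum_expect_isolatedEdge (k : ℕ) (p : ℝ) :
    expect (pairProb p) (isolatedEdges (V := V) k) = ∑ e ∈ (Finset.univ : Finset V).powersetCard 2,
      p * expect (pairProb p) (inextensible k e) :=
  (expect_sum _ _ _).trans <| Finset.sum_congr rfl fun _ he =>
    expect_isolatedEdge k (Finset.mem_powersetCard.1 he).2 p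

/-- The union bound for the probability that some edge lies in no clique. -/
lemma real_not_everyEdgeInClique_le {k : ℕ} (p : unitInterval) {B : ℝ}
    (hB : ∀ e : Finset V, e.card = 2 → expect (pairProb (p : ℝ)) (inextensible k e) ≤ B) :
    (SimpleGraph.binomialRandom V p).real {G | ¬ EveryEdgeInClique (k + 2) G}
      ≤ (Fintype.card V).choose 2 * (p * B) := by
  classical
  rw [binomialRandom_real_eq_expect]
  have h : ∀ ω : Finset (Finset V), (if ¬ EveryEdgeInClique (k + 2) (ofPairs ω) then (1 : ℝ) else 0)
      ≤ isolatedEdges k ω := fun ω => by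
    split_ifs with h
    · exact isolatedEdges_nonneg k ω
    · obtain ⟨e, he, h1⟩ := not_everyEdgeInClique_iff.1 h
      rw [← h1]
      exact Finset.single_le_sum (f := fun e => isolatedEdge k e ω)
        (fun e _ => isolatedEdge_nonneg k e ω) he
  refine (expect_mono (pairProb_nonneg p.2.1) (pairProb_le_one p.2.2) h).trans ?_
  rw [sum_expect_isolatedEdge]
  refine (Finset.sum_le_card_nsmul _ _ (p * B) fun e he => ?_).trans_eq ?_
  · exact mul_le_mul_of_nonneg_left (hB e (Finset.mem_powersetCard.1 he).2) p.2.1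
  · rw [nsmul_eq_mul, Finset.card_powersetCard, Finset.card_univ]

/-- Keeping only the extensions by sets disjoint from `e ∪ e'` weakens the event. These extensions
use neither `e` nor `e'`, so the presence of both edges factors out as `p ^ 2`. -/
lemma expect_isolatedEdge_mul_le {k : ℕ} {e e' : Finset V} (he : e.card = 2) (he' : e'.card = 2)
    (hne : e ≠ e') {p : ℝ} (hp : 0 ≤ p) (hp1 : p ≤ 1) :
    expect (pairProb p) (fun ω => isolatedEdge k e ω * isolatedEdge k e' ω)
      ≤ p ^ 2 * expect (pairProb p) (avoids (fun i : Finset V × Finset V => extension i.1 i.2)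
        ({e, e'} ×ˢ (Finset.univ \ ({e, e'} : Finset (Finset V)).biUnion id).powersetCard k)) := by
  set A := (Finset.univ \ ({e, e'} : Finset (Finset V)).biUnion id).powersetCard k with hA
  have hd : ∀ S ∈ A, Disjoint S e ∧ Disjoint S e' := fun S hS => by
    have h := (Finset.subset_sdiff.1 (Finset.mem_powersetCard.1 hS).1).2
    exact ⟨h.mono_right (Finset.subset_biUnion_of_mem id (by simp)),
      h.mono_right (Finset.subset_biUnion_of_mem id (by simp))⟩
  have hnot : ∀ {a b S : Finset V}, a.card = 2 → b.card = 2 → a ≠ b → Disjoint S a →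
      a ∉ extension b S := fun {a b S} ha hb hab hSa hmem => by
    have h1 := (Finset.mem_powersetCard.1 (Finset.mem_of_mem_erase hmem)).1
    have h2 : a ⊆ b := fun x hx => (Finset.mem_union.1 (h1 hx)).resolve_left
      (Finset.disjoint_right.1 hSa hx)
    exact hab (Finset.eq_of_subset_of_card_le h2 (by omega))
  have hdisj : ∀ i ∈ ({e, e'} : Finset (Finset V)) ×ˢ A,
      Disjoint (extension i.1 i.2) {e, e'} := by
    rintro ⟨a, S⟩ hi
    obtain ⟨ha, hS⟩ := Finset.mem_product.1 hi
    rw [Finset.disjoint_insert_right, Finset.disjoint_singleton_right]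
    simp only [Finset.mem_insert, Finset.mem_singleton] at ha
    rcases ha with rfl | rfl
    · exact ⟨notMem_extension _ _, hnot he' he hne.symm (hd S hS).2⟩
    · exact ⟨hnot he he' hne (hd S hS).1, notMem_extension _ _⟩
  have heq := expect_subset_of_forall_union (p := pairProb p) {e, e'} (avoids_union_eq hdisj)
  rw [prod_pairProb_eq_pow (by simp [he, he']), Finset.card_pair hne] at heq
  rw [← heq]
  refine expect_mono (pairProb_nonneg hp) (pairProb_le_one hp1) fun ω => ?_
  have hle : ∀ a, A ⊆ (Finset.univ \ a).powersetCard k →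
      inextensible k a ω ≤ avoids (extension a) A ω := fun a ha => by
    rcases inextensible_eq_one_or_zero k a ω with ⟨h1, h2⟩ | ⟨h1, h2⟩
    · rw [h1]
      exact (Finset.prod_eq_one fun S hS => if_neg (h2 S (ha hS))).ge
    · rw [h1]
      exact avoids_nonneg ω
  have hAe : A ⊆ (Finset.univ \ e).powersetCard k := Finset.powersetCard_mono
    (Finset.sdiff_subset_sdiff subset_rfl (Finset.subset_biUnion_of_mem id (by simp)))
  have hAe' : A ⊆ (Finset.univ \ e').powersetCard k := Finset.powersetCard_mono
    (Finset.sdiff_subset_sdiff subset_rfl (Finset.subset_biUnion_of_mem id (by simp)))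
  have hprod : avoids (fun i : Finset V × Finset V => extension i.1 i.2) ({e, e'} ×ˢ A) ω
      = avoids (extension e) A ω * avoids (extension e') A ω := by
    unfold avoids
    rw [Finset.prod_product, Finset.prod_pair hne]
  rw [hprod, isolatedEdge, isolatedEdge]
  by_cases h1 : e ∈ ω <;> by_cases h2 : e' ∈ ω <;>
    simp only [Finset.singleton_subset_iff, Finset.insert_subset_iff, h1, h2, if_true, if_false,
      mul_zero, zero_mul, true_and, false_and, le_refl, and_self]
  exact mul_le_mul (hle e hAe) (hle e' hAe') (avoids_nonneg ω) (avoids_nonneg ω)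

lemma isolatedEdge_mul_self (k : ℕ) (e : Finset V) (ω : Finset (Finset V)) :
    isolatedEdge k e ω * isolatedEdge k e ω = isolatedEdge k e ω := by
  rw [isolatedEdge]
  rcases inextensible_eq_one_or_zero k e ω with ⟨h1, -⟩ | ⟨h1, -⟩ <;> rw [h1] <;> simp

/-- The second moment bound for the probability that some edge lies in no clique. -/
lemma le_real_not_everyEdgeInClique {k : ℕ} (p : unitInterval) {v f B : ℝ}
    (hf : ∀ e : Finset V, e.card = 2 → f ≤ expect (pairProb (p : ℝ)) (inextensible k e))
    (hv : 0 < v) (hvf : v ≤ (Fintype.card V).choose 2 * (p * f))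
    (hB : ∀ e e' : Finset V, e.card = 2 → e'.card = 2 → e ≠ e' →
      expect (pairProb (p : ℝ)) (avoids (fun i : Finset V × Finset V => extension i.1 i.2)
        ({e, e'} ×ˢ (Finset.univ \ ({e, e'} : Finset (Finset V)).biUnion id).powersetCard k)) ≤ B)
    (hB0 : 0 ≤ B) :
    v ^ 2 / (v + ((Fintype.card V).choose 2 * p) ^ 2 * B)
      ≤ (SimpleGraph.binomialRandom V p).real {G | ¬ EveryEdgeInClique (k + 2) G} := by
  classical
  have h0 := pairProb_nonneg (V := V) p.2.1
  have h1 := pairProb_le_one (V := V) p.2.2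
  set N : ℝ := (((Fintype.card V).choose 2 : ℕ) : ℝ) with hN
  have hcard : (((Finset.univ : Finset V).powersetCard 2).card : ℝ) = N := by
    rw [Finset.card_powersetCard, Finset.card_univ]
  set U := (N * p) ^ 2 * B with hU
  have hU0 : 0 ≤ U := by positivity
  rw [binomialRandom_real_eq_expect]
  set a := expect (pairProb (p : ℝ)) (isolatedEdges (V := V) k) with ha
  have hva : v ≤ a := by
    refine hvf.trans ?_
    rw [ha, sum_expect_isolatedEdge, ← hcard, ← nsmul_eq_mul]
    exact Finset.card_nsmul_le_sum _ _ _ fun e he =>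
      mul_le_mul_of_nonneg_left (hf e (Finset.mem_powersetCard.1 he).2) p.2.1
  -- The diagonal terms are squares of indicators and add up to the mean `a`; the off-diagonal ones
  -- are at most `p ^ 2 * B` each.
  have hsq : expect (pairProb (p : ℝ)) (fun ω => isolatedEdges (V := V) k ω ^ 2) ≤ a + U := by
    have e1 : ∀ ω, isolatedEdges (V := V) k ω ^ 2 = ∑ e ∈ Finset.univ.powersetCard 2,
        ∑ e' ∈ Finset.univ.powersetCard 2, isolatedEdge k e ω * isolatedEdge k e' ω := fun ω => by
      rw [sq, isolatedEdges, Finset.sum_mul_sum]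
    simp only [e1]
    rw [expect_sum, ha]
    have e2 : ∀ e ∈ (Finset.univ : Finset V).powersetCard 2,
        expect (pairProb (p : ℝ)) (fun ω => ∑ e' ∈ Finset.univ.powersetCard 2,
          isolatedEdge k e ω * isolatedEdge k e' ω)
        ≤ expect (pairProb (p : ℝ)) (isolatedEdge k e) + N * (p ^ 2 * B) := fun e he => by
      have hpB : 0 ≤ (p : ℝ) ^ 2 * B := by positivity
      rw [expect_sum, ← Finset.add_sum_erase _ _ he]
      simp only [isolatedEdge_mul_self]
      refine add_le_add le_rfl ?_
      refine (Finset.sum_le_card_nsmul _ _ (p ^ 2 * B) fun e' he' => ?_).trans ?_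
      · obtain ⟨hne, he'⟩ := Finset.mem_erase.1 he'
        have c1 := (Finset.mem_powersetCard.1 he).2
        have c2 := (Finset.mem_powersetCard.1 he').2
        exact (expect_isolatedEdge_mul_le c1 c2 hne.symm p.2.1 p.2.2).trans
          (mul_le_mul_of_nonneg_left (hB e e' c1 c2 hne.symm) (by positivity))
      · rw [nsmul_eq_mul, ← hcard]
        exact mul_le_mul_of_nonneg_right (Nat.cast_le.2 (Finset.card_erase_le)) hpB
    refine (Finset.sum_le_sum e2).trans ?_
    rw [Finset.sum_add_distrib, Finset.sum_const, nsmul_eq_mul, hcard, ← expect_sum]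
    refine add_le_add le_rfl (le_of_eq ?_)
    rw [hU]; ring
  have hcs := sq_expect_le h0 h1 (isolatedEdges k)
  simp only [isolatedEdges_ne_zero_iff] at hcs
  set P := expect (pairProb (p : ℝ))
    (fun ω : Finset (Finset V) => if ¬ EveryEdgeInClique (k + 2) (ofPairs ω) then 1 else 0) with hP
  have hP0 : 0 ≤ P := expect_nonneg h0 h1 fun ω => by split_ifs <;> norm_num
  have h2 : a ^ 2 ≤ P * (a + U) := hcs.trans (mul_le_mul_of_nonneg_left hsq hP0)
  have ha0 : 0 < a := hv.trans_le hva
  -- `t ^ 2 / (t + U)` is increasing in `t`, so the mean may be replaced by its lower bound `v`.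
  calc v ^ 2 / (v + U) ≤ a ^ 2 / (a + U) := by
        rw [div_le_div_iff₀ (by positivity) (by positivity)]
        nlinarith [mul_nonneg (mul_nonneg hv.le ha0.le) (sub_nonneg.2 hva),
          mul_nonneg hU0 (mul_nonneg (add_nonneg hv.le ha0.le) (sub_nonneg.2 hva))]
    _ ≤ P := by rwa [div_le_iff₀ (by positivity)]

lemma expect_inextensible_antitone {k : ℕ} (e : Finset V) {p q : ℝ} (hp : 0 ≤ p) (hpq : p ≤ q)
    (hq : q ≤ 1) :
    expect (pairProb q) (inextensible k e) ≤ expect (pairProb p) (inextensible k e) :=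
  expect_antitone (pairProb_nonneg hp) (fun a => by unfold pairProb; split_ifs <;> simp [hpq])
    (pairProb_le_one hq) avoids_antitone

/-- Positive correlation of the events that the individual extensions are absent. -/
lemma le_expect_inextensible {k : ℕ} {e : Finset V} (he : e.card = 2) {p : ℝ} (hp : 0 ≤ p)
    (hp1 : p ≤ 1) :
    (1 - p ^ ((k + 2).choose 2 - 1)) ^ (Fintype.card V - 2).choose k
      ≤ expect (pairProb p) (inextensible k e) := by
  refine le_trans (le_of_eq ?_) (prod_one_sub_le_expect_avoids (T := extension e)
    (J := (Finset.univ \ e).powersetCard k) (pairProb_nonneg hp) (pairProb_le_one hp1))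
  rw [← he, ← Finset.card_univ_sdiff, ← Finset.card_powersetCard, he, ← Finset.prod_const]
  refine Finset.prod_congr rfl fun S hS => ?_
  obtain ⟨h1, h2⟩ := Finset.mem_powersetCard.1 hS
  rw [prod_pairProb_eq_pow fun a => card_eq_two_of_mem_extension,
    card_extension he (Finset.subset_sdiff.1 h1).2, h2]

lemma expect_inextensible_le {k : ℕ} {e : Finset V} (he : e.card = 2) {p y : ℝ} (hp : 0 ≤ p)
    (hpy : p ≤ y ^ 2) (hy0 : 0 < y) (hy1 : y ≤ 1) (hny : 1 ≤ Fintype.card V * y ^ (k + 2)) :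
    expect (pairProb p) (inextensible k e)
      ≤ Real.exp (-((Fintype.card V - 2).choose k * p ^ ((k + 2).choose 2 - 1))
          + 2 ^ k * (((Fintype.card V : ℝ) ^ k * (y ^ 2) ^ ((k + 2).choose 2 - 1)) ^ 2
              / (Fintype.card V * y ^ (k + 2)))) := by
  have h := expect_avoids_extension_le (F := {e}) (by simpa using he) hp hpy hy0 hy1 hny
  simp only [Finset.card_singleton, Finset.singleton_biUnion, Nat.cast_one, one_mul, mul_one,
    one_pow, id] at h
  refine le_of_eq_of_le ?_ h
  congr 1
  funext ω
  rw [inextensible, avoids, avoids, Finset.prod_product, Finset.prod_singleton]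

end Moments

end RandomGraph

/-! ### Exact identities and growth at the critical probability. -/

namespace RandomGraph

/-- The number of edges of a clique on `k + 2` vertices, without one edge. -/
def extensionSize (k : ℕ) : ℕ := (k + 2).choose 2 - 1

/-- The critical edge probability `c_s q_s(n)` for `s = k + 2`. -/
noncomputable def criticalProb (k n : ℕ) : ℝ := cliqueConst (k + 2) * cliqueScale (k + 2) n

/-- The approximate expected number of extensions of a pair to a clique on `k + 2` vertices. -/
noncomputable def meanExtensions (k n : ℕ) (p : ℝ) : ℝ :=
  (n : ℝ) ^ k * p ^ extensionSize k / k.factorial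

/-- The constant `2 (1 - 1 / (s + 1))` for `s = k + 2`. -/
noncomputable def rate (k : ℕ) : ℝ := 2 * (1 - 1 / ((k : ℝ) + 3))

lemma two_mul_extensionSize (k : ℕ) : 2 * extensionSize k = k * (k + 3) := by
  have h : 2 * (k + 2).choose 2 = (k + 2) * (k + 1) := by
    rw [Nat.choose_two_right, Nat.mul_div_cancel' (Nat.even_mul_pred_self _).two_dvd]; rfl
  rw [extensionSize, Nat.mul_sub, h]
  exact Nat.sub_eq_of_eq_add (by ring)

lemma extensionSize_cast (k : ℕ) : (extensionSize k : ℝ) = k * (k + 3) / 2 := by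
  have h : (2 : ℝ) * extensionSize k = k * (k + 3) := mod_cast two_mul_extensionSize k
  linarith

lemma rate_eq (k : ℕ) : rate k = 2 * (k + 2) / (k + 3) := by
  unfold rate
  field_simp
  ring

lemma one_le_rate (k : ℕ) : 1 ≤ rate k := by
  rw [rate_eq, le_div_iff₀ (by positivity)]
  linarith [(Nat.cast_nonneg k : (0 : ℝ) ≤ k)]

lemma rate_mul_extensionSize (k : ℕ) : rate k * extensionSize k = k * (k + 2) := by
  rw [rate_eq, extensionSize_cast]
  field_simp

lemma cliqueConst_add_two (k : ℕ) :
    cliqueConst (k + 2) = (rate k * k.factorial) ^ (2 / (((k : ℝ) + 3) * k)) := by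
  unfold cliqueConst rate
  push_cast
  congr 2 <;> ring

lemma cliqueScale_add_two (k n : ℕ) :
    cliqueScale (k + 2) n
      = (n : ℝ) ^ (-(2 / ((k : ℝ) + 3))) * Real.log n ^ (2 / ((k : ℝ) * (k + 3))) := by
  unfold cliqueScale
  push_cast
  congr 3 <;> ring

lemma cliqueConst_pos (k : ℕ) : 0 < cliqueConst (k + 2) := by
  have := one_le_rate k
  rw [cliqueConst_add_two]
  positivity

lemma log_pos_of_three_le {n : ℕ} (hn : 3 ≤ n) : 1 < Real.log n := by
  rw [Real.lt_log_iff_exp_lt (by positivity)]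
  have : (3 : ℝ) ≤ n := mod_cast hn
  linarith [Real.exp_one_lt_d9]

lemma criticalProb_pos {k n : ℕ} (hn : 3 ≤ n) : 0 < criticalProb k n := by
  have := log_pos_of_three_le hn
  have h3 : (0 : ℝ) < n := by positivity
  rw [criticalProb, cliqueScale_add_two]
  have := cliqueConst_pos k
  positivity

/-- The exponent `2 / (k (k + 3))` in `c_s` and on the logarithm is `1 / extensionSize k`, so the
power undoes it and the powers of `n` cancel. -/
lemma meanExtensions_criticalProb_mul {k n : ℕ} (hk : 1 ≤ k) (hn : 3 ≤ n) (t : ℝ) :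
    meanExtensions k n (criticalProb k n * t) = rate k * Real.log n * t ^ extensionSize k := by
  have hL := log_pos_of_three_le hn
  have hk0 : (0 : ℝ) < k := by positivity
  have hn0 : (0 : ℝ) < n := by positivity
  have hA := one_le_rate k
  have hf : (0 : ℝ) < k.factorial := by positivity
  have h1 : cliqueConst (k + 2) ^ extensionSize k = rate k * k.factorial := by
    rw [cliqueConst_add_two, ← Real.rpow_natCast, ← Real.rpow_mul (by positivity),
      extensionSize_cast]
    convert Real.rpow_one _ using 2
    field_simp
  have h2 : cliqueScale (k + 2) n ^ extensionSize k = ((n : ℝ) ^ k)⁻¹ * Real.log n := by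
    rw [cliqueScale_add_two, mul_pow, ← Real.rpow_natCast, ← Real.rpow_natCast,
      ← Real.rpow_mul (by positivity), ← Real.rpow_mul (by positivity), extensionSize_cast]
    congr 1
    · rw [← Real.rpow_natCast (n : ℝ) k, ← Real.rpow_neg (by positivity)]
      congr 1
      field_simp
    · convert Real.rpow_one _ using 2
      field_simp
  rw [meanExtensions, criticalProb, mul_pow, mul_pow, h1, h2]
  field_simp

/-- Here `2 - 2 / (k + 3) = rate k`: the constant in `c_s` makes `exp (-M)` cancel exactly this
power of `n`. -/
lemma sq_mul_criticalProb {k n : ℕ} (hn : 3 ≤ n) :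
    (n : ℝ) ^ 2 * criticalProb k n = cliqueConst (k + 2)
      * Real.exp (rate k * Real.log n + 2 / ((k : ℝ) * (k + 3)) * Real.log (Real.log n)) := by
  have hL := log_pos_of_three_le hn
  have hn0 : (0 : ℝ) < n := by positivity
  have h2 : (n : ℝ) ^ 2 = (n : ℝ) ^ (2 : ℝ) := by norm_cast
  rw [criticalProb, cliqueScale_add_two, h2, mul_left_comm, ← mul_assoc ((n : ℝ) ^ (2 : ℝ)),
    ← Real.rpow_add hn0, Real.rpow_def_of_pos hn0, Real.rpow_def_of_pos (by linarith),
    ← Real.exp_add]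
  congr 2
  rw [rate_eq]
  field_simp
  ring

lemma le_criticalProb {k n : ℕ} (hn : 3 ≤ n) :
    cliqueConst (k + 2) * (n : ℝ) ^ (-(2 / ((k : ℝ) + 3))) ≤ criticalProb k n := by
  have hL := log_pos_of_three_le hn
  rw [criticalProb, cliqueScale_add_two, ← mul_assoc]
  refine le_mul_of_one_le_right ?_ (Real.one_le_rpow hL.le (by positivity))
  have := cliqueConst_pos k
  positivity

lemma tendsto_log_natCast_atTop : Tendsto (fun n : ℕ => Real.log n) atTop atTop :=
  Real.tendsto_log_atTop.comp tendsto_natCast_atTop_atTop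

lemma tendsto_log_rpow_div_rpow (r : ℝ) {g : ℝ} (hg : 0 < g) :
    Tendsto (fun n : ℕ => Real.log n ^ r / (n : ℝ) ^ g) atTop (𝓝 0) :=
  ((isLittleO_log_rpow_rpow_atTop r hg).tendsto_div_nhds_zero).comp tendsto_natCast_atTop_atTop

lemma tendsto_criticalProb (k : ℕ) : Tendsto (criticalProb k) atTop (𝓝 0) := by
  have h := (tendsto_log_rpow_div_rpow (2 / ((k : ℝ) * (k + 3)))
    (g := 2 / ((k : ℝ) + 3)) (by positivity)).const_mul (cliqueConst (k + 2))
  rw [mul_zero] at h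
  refine h.congr fun n => ?_
  rw [criticalProb, cliqueScale_add_two, Real.rpow_neg (Nat.cast_nonneg n)]
  ring

/-- Gives the crude bound `p / criticalProb k n ≤ n` for any probability `p`. -/
lemma eventually_one_le_mul_criticalProb {k : ℕ} (hk : 1 ≤ k) :
    ∀ᶠ n : ℕ in atTop, 1 ≤ n * criticalProb k n := by
  have hk1 : (1 : ℝ) ≤ k := mod_cast hk
  have hg : 0 < 1 - 2 / ((k : ℝ) + 3) := by
    rw [sub_pos, div_lt_one (by positivity)]
    linarith
  have h := ((tendsto_rpow_atTop hg).comp tendsto_natCast_atTop_atTop).const_mul_atTop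
    (cliqueConst_pos k)
  filter_upwards [h.eventually_ge_atTop 1, eventually_ge_atTop 3] with n h1 hn
  refine h1.trans ?_
  have hn0 : (0 : ℝ) < n := by positivity
  have h2 := mul_le_mul_of_nonneg_left (le_criticalProb (k := k) hn) hn0.le
  refine le_trans (le_of_eq ?_) h2
  simp only [Function.comp]
  rw [sub_eq_add_neg, Real.rpow_add hn0, Real.rpow_one]
  ring

/-- The geometric quantity controlling the dependence between overlapping extensions. -/
lemma exists_le_mul_sqrt_pow (k : ℕ) : ∃ c : ℝ, 0 < c ∧ ∀ n : ℕ, 3 ≤ n →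
    c * (n : ℝ) ^ (1 / ((k : ℝ) + 3)) ≤ n * √(2 * criticalProb k n) ^ (k + 2) := by
  have hc := cliqueConst_pos k
  refine ⟨√(2 * cliqueConst (k + 2)) ^ (k + 2), by positivity, fun n hn => ?_⟩
  have hn0 : (0 : ℝ) < n := by positivity
  have h1 : √(2 * cliqueConst (k + 2)) * (n : ℝ) ^ (-(1 / ((k : ℝ) + 3)))
      ≤ √(2 * criticalProb k n) := by
    refine Real.le_sqrt_of_sq_le ?_
    rw [mul_pow, Real.sq_sqrt (by positivity), ← Real.rpow_natCast, ← Real.rpow_mul hn0.le]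
    have h := le_criticalProb (k := k) hn
    have he : -(1 / ((k : ℝ) + 3)) * (2 : ℕ) = -(2 / ((k : ℝ) + 3)) := by push_cast; ring
    rw [he]
    linarith
  have h2 := mul_le_mul_of_nonneg_left (pow_le_pow_left₀ (by positivity) h1 (k + 2)) hn0.le
  refine le_trans (le_of_eq ?_) h2
  -- The surviving exponent is `1 - (k + 2) / (k + 3) = 1 / (k + 3)`.
  have h3 : (n : ℝ) * ((n : ℝ) ^ (-(1 / ((k : ℝ) + 3)))) ^ (k + 2)
      = (n : ℝ) ^ (1 / ((k : ℝ) + 3)) := by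
    rw [← Real.rpow_natCast, ← Real.rpow_mul hn0.le]
    nth_rewrite 1 [← Real.rpow_one (n : ℝ)]
    rw [← Real.rpow_add hn0]
    congr 1
    push_cast
    field_simp
    ring
  rw [mul_pow, ← h3]
  ring

end RandomGraph

/-! ### Uniform estimates up to twice the critical probability. -/

namespace RandomGraph

open RandomSubset

/-- Two pairs leave at least `n - 4` vertices. The falling factorial is at least `(n - (k + 3)) ^
k`, and Bernoulli's inequality does the rest. -/
lemma le_choose_sub_four {k n : ℕ} (hn : k + 3 ≤ n) :
    (1 - k * (k + 3) / (n : ℝ)) * ((n : ℝ) ^ k / k.factorial) ≤ ((n - 4).choose k : ℕ) := by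
  have hn0 : (0 : ℝ) < n := by
    have : 0 < n := by omega
    positivity
  have hf : (0 : ℝ) < k.factorial := by positivity
  have h1 : (n - (k + 3)) ^ k ≤ k.factorial * (n - 4).choose k := by
    rw [← Nat.descFactorial_eq_factorial_mul_choose]
    refine le_trans (Nat.pow_le_pow_left ?_ k) (Nat.pow_sub_le_descFactorial (n - 4) k)
    omega
  have h2 : ((n : ℝ) - (k + 3)) ^ k ≤ k.factorial * ((n - 4).choose k : ℕ) := by
    have h : (((n - (k + 3)) ^ k : ℕ) : ℝ) ≤ (k.factorial * (n - 4).choose k : ℕ) := mod_cast h1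
    rw [Nat.cast_pow, Nat.cast_sub hn] at h
    push_cast at h
    exact h
  have h3 : 1 - k * (k + 3) / (n : ℝ) ≤ (1 - (k + 3) / (n : ℝ)) ^ k := by
    have hle : ((k : ℝ) + 3) / n ≤ 1 := by
      rw [div_le_one hn0]; exact_mod_cast hn
    have h := one_add_mul_le_pow (a := -((k + 3) / (n : ℝ))) (by linarith) k
    refine le_trans (le_of_eq ?_) (h.trans (le_of_eq ?_)) <;> ring
  have h4 : (1 - (k + 3) / (n : ℝ)) ^ k * (n : ℝ) ^ k = ((n : ℝ) - (k + 3)) ^ k := by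
    rw [← mul_pow]; congr 1; field_simp
  rw [← mul_div_assoc, div_le_iff₀ hf]
  calc (1 - k * (k + 3) / (n : ℝ)) * (n : ℝ) ^ k ≤ (1 - (k + 3) / (n : ℝ)) ^ k * (n : ℝ) ^ k := by
        gcongr
    _ ≤ _ := by rw [h4]; linarith

lemma exp_neg_le_one_sub {t : ℝ} (ht : t ≤ 1 / 2) :
    Real.exp (-(t + 2 * t ^ 2)) ≤ 1 - t := by
  have h1 : 0 < 1 - t := by linarith
  rw [← Real.le_log_iff_exp_le h1]
  refine le_trans ?_ (Real.one_sub_inv_le_log_of_pos h1)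
  have h2 : (1 - t)⁻¹ ≤ 1 + t + 2 * t ^ 2 := by
    rw [inv_le_iff_one_le_mul₀ h1]
    nlinarith [mul_nonneg (sq_nonneg t) (by linarith : 0 ≤ 1 - 2 * t)]
  linarith

lemma meanExtensions_le {k n : ℕ} (hk : 1 ≤ k) (hn : 3 ≤ n) {p : ℝ} (hp : 0 ≤ p)
    (hpx : p ≤ 2 * criticalProb k n) :
    meanExtensions k n p ≤ rate k * 2 ^ extensionSize k * Real.log n := by
  have h := meanExtensions_criticalProb_mul hk hn 2
  have h2 : meanExtensions k n p ≤ meanExtensions k n (criticalProb k n * 2) := by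
    unfold meanExtensions
    gcongr
    linarith
  rw [h] at h2
  linarith

lemma meanExtensions_nonneg {k n : ℕ} {p : ℝ} (hp : 0 ≤ p) : 0 ≤ meanExtensions k n p := by
  unfold meanExtensions; positivity

/-- The edge probability raised to the number of edges of an extension is negligible. -/
lemma pow_extensionSize_le {k n : ℕ} (hk : 1 ≤ k) (hn : 3 ≤ n) {p : ℝ} (hp : 0 ≤ p)
    (hpx : p ≤ 2 * criticalProb k n) :
    p ^ extensionSize k ≤ k.factorial * (rate k * 2 ^ extensionSize k) * (Real.log n / n) := by
  have h := meanExtensions_le hk hn hp hpx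
  have hn1 : (1 : ℝ) ≤ n := by
    have : 1 ≤ n := by omega
    exact_mod_cast this
  have hL := log_pos_of_three_le hn
  have hf : (0 : ℝ) < k.factorial := by positivity
  have hA := one_le_rate k
  have h1 : (n : ℝ) ≤ (n : ℝ) ^ k := le_self_pow₀ hn1 (by omega)
  have hpm : 0 ≤ p ^ extensionSize k := by positivity
  rw [meanExtensions, div_le_iff₀ hf] at h
  rw [mul_div_assoc', le_div_iff₀ (by linarith)]
  nlinarith [mul_le_mul_of_nonneg_right h1 hpm]

/-- A common bound for the error terms in the estimates of the extension probabilities. -/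
noncomputable def errorBound (k : ℕ) (c : ℝ) (n : ℕ) : ℝ :=
  k * (k + 3) * (rate k * 2 ^ extensionSize k) * (2 * (Real.log n / n))
    + 2 * (k.factorial * (rate k * 2 ^ extensionSize k) ^ 2) * (Real.log n ^ 2 / n)
    + 4 * 2 ^ k * (k.factorial * (rate k * 2 ^ extensionSize k)) ^ 2 / c
      * (Real.log n ^ 2 / (n : ℝ) ^ (1 / ((k : ℝ) + 3)))

lemma tendsto_errorBound (k : ℕ) (c : ℝ) : Tendsto (errorBound k c) atTop (𝓝 0) := by
  have h1 : Tendsto (fun n : ℕ => Real.log n / n) atTop (𝓝 0) := by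
    simpa using tendsto_log_rpow_div_rpow 1 one_pos
  have h2 : Tendsto (fun n : ℕ => Real.log n ^ 2 / n) atTop (𝓝 0) := by
    simpa using tendsto_log_rpow_div_rpow 2 one_pos
  have h3 : Tendsto (fun n : ℕ => Real.log n ^ 2 / (n : ℝ) ^ (1 / ((k : ℝ) + 3))) atTop (𝓝 0) := by
    simpa using tendsto_log_rpow_div_rpow 2 (g := 1 / ((k : ℝ) + 3)) (by positivity)
  have h := (((h1.const_mul 2).const_mul (k * (k + 3) * (rate k * 2 ^ extensionSize k))).add
    (h2.const_mul (2 * (k.factorial * (rate k * 2 ^ extensionSize k) ^ 2)))).add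
    (h3.const_mul (4 * 2 ^ k * (k.factorial * (rate k * 2 ^ extensionSize k)) ^ 2 / c))
  simp only [mul_zero, add_zero] at h
  exact h

lemma expect_inextensible_bounds {k n : ℕ} {c η : ℝ} (hk : 1 ≤ k) (hn : k + 3 ≤ n) (hc : 0 < c)
    (hcn : c * (n : ℝ) ^ (1 / ((k : ℝ) + 3)) ≤ n * √(2 * criticalProb k n) ^ (k + 2))
    (h1n : 1 ≤ n * √(2 * criticalProb k n) ^ (k + 2)) (hx : 2 * criticalProb k n ≤ 1)
    (hhalf : k.factorial * (rate k * 2 ^ extensionSize k) * (Real.log n / n) ≤ 1 / 2)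
    (hη : errorBound k c n ≤ η) {p : ℝ} (hp : 0 ≤ p) (hpx : p ≤ 2 * criticalProb k n) :
    (∀ e : Finset (Fin n), e.card = 2 →
      expect (pairProb p) (inextensible k e) ≤ Real.exp (-meanExtensions k n p + η)) ∧
    (∀ e e' : Finset (Fin n), e.card = 2 → e'.card = 2 → e ≠ e' →
      expect (pairProb p) (avoids (fun i : Finset (Fin n) × Finset (Fin n) => extension i.1 i.2)
        ({e, e'} ×ˢ (Finset.univ \ ({e, e'} : Finset (Finset (Fin n))).biUnion id).powersetCard k))
      ≤ Real.exp (-(2 * meanExtensions k n p) + η)) ∧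
    (∀ e : Finset (Fin n), e.card = 2 →
      Real.exp (-meanExtensions k n p - η) ≤ expect (pairProb p) (inextensible k e)) := by
  have hn3 : 3 ≤ n := by omega
  have hn0 : (0 : ℝ) < n := by positivity
  have hL := log_pos_of_three_le hn3
  have hx0 := criticalProb_pos (k := k) hn3
  have hA := one_le_rate k
  have hM := meanExtensions_le hk hn3 hp hpx
  have hM0 := meanExtensions_nonneg (k := k) (n := n) hp
  have hf : (0 : ℝ) < k.factorial := by positivity
  have hsq : √(2 * criticalProb k n) ^ 2 = 2 * criticalProb k n := Real.sq_sqrt (by positivity)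
  have hpy : p ≤ √(2 * criticalProb k n) ^ 2 := by rwa [hsq]
  have hy0 : 0 < √(2 * criticalProb k n) := Real.sqrt_pos.2 (by positivity)
  have hy1 : √(2 * criticalProb k n) ≤ 1 := Real.sqrt_le_one.2 hx
  have hp1 : p ≤ 1 := hpx.trans hx
  set Q := rate k * 2 ^ extensionSize k with hQ
  have hQ0 : 0 < Q := by positivity
  -- `E1` pays for replacing the binomial coefficient by `n ^ k / k!` (half of it per pair), `E2`
  -- for replacing `1 - t` by an exponential in the lower bound, `E3` for the dependence term in
  -- Janson; its factor `4` is the square of the number of pairs.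
  set E1 := k * (k + 3) * Q * (2 * (Real.log n / n)) with hE1
  set E2 := 2 * (k.factorial * Q ^ 2) * (Real.log n ^ 2 / n) with hE2
  set E3 := 4 * 2 ^ k * (k.factorial * Q) ^ 2 / c
      * (Real.log n ^ 2 / (n : ℝ) ^ (1 / ((k : ℝ) + 3))) with hE3
  have hE1' : 0 ≤ E1 := by positivity
  have hE2' : 0 ≤ E2 := by positivity
  have hE3' : 0 ≤ E3 := by positivity
  have hsum : E1 + E2 + E3 ≤ η := hη
  have hdep : 4 * 2 ^ k * (((n : ℝ) ^ k * (√(2 * criticalProb k n) ^ 2) ^ extensionSize k) ^ 2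
      / (n * √(2 * criticalProb k n) ^ (k + 2))) ≤ E3 := by
    have h1 : (n : ℝ) ^ k * (√(2 * criticalProb k n) ^ 2) ^ extensionSize k
        = k.factorial * Q * Real.log n := by
      have h := meanExtensions_criticalProb_mul hk hn3 2
      rw [meanExtensions, div_eq_iff hf.ne'] at h
      rw [hsq, mul_comm 2, h, hQ]
      ring
    rw [h1]
    calc 4 * 2 ^ k * ((k.factorial * Q * Real.log n) ^ 2
          / (n * √(2 * criticalProb k n) ^ (k + 2)))
        ≤ 4 * 2 ^ k * ((k.factorial * Q * Real.log n) ^ 2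
          / (c * (n : ℝ) ^ (1 / ((k : ℝ) + 3)))) := by gcongr
      _ = E3 := by rw [hE3]; field_simp
  have hch : meanExtensions k n p - E1 / 2 ≤ ((n - 4).choose k : ℕ) * p ^ extensionSize k := by
    have h := mul_le_mul_of_nonneg_right (le_choose_sub_four hn)
      (by positivity : 0 ≤ p ^ extensionSize k)
    refine le_trans ?_ h
    have h2 : (1 - k * (k + 3) / (n : ℝ)) * ((n : ℝ) ^ k / k.factorial) * p ^ extensionSize k
        = meanExtensions k n p - k * (k + 3) / (n : ℝ) * meanExtensions k n p := by
      rw [meanExtensions]; ring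
    rw [h2, hE1]
    have h3 : k * (k + 3) / (n : ℝ) * meanExtensions k n p
        ≤ k * (k + 3) / (n : ℝ) * (Q * Real.log n) :=
      mul_le_mul_of_nonneg_left hM (by positivity)
    have h4 : k * (k + 3) * Q * (2 * (Real.log n / n)) / 2
        = k * (k + 3) / (n : ℝ) * (Q * Real.log n) := by ring
    linarith
  have hch2 : (((n - 4).choose k : ℕ) : ℝ) * p ^ extensionSize k
      ≤ ((n - 2).choose k : ℕ) * p ^ extensionSize k := by
    gcongr
    omega
  refine ⟨fun e he => ?_, fun e e' he he' hne => ?_, fun e he => ?_⟩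
  · have h := expect_inextensible_le (k := k) he hp hpy hy0 hy1 (by simpa using h1n)
    simp only [Fintype.card_fin] at h
    refine h.trans (Real.exp_le_exp.2 ?_)
    have hd : 2 ^ k * (((n : ℝ) ^ k * (√(2 * criticalProb k n) ^ 2) ^ extensionSize k) ^ 2
      / (n * √(2 * criticalProb k n) ^ (k + 2))) ≤ E3 := by
      refine le_trans ?_ hdep
      rw [mul_assoc 4]
      exact le_mul_of_one_le_left (by positivity) (by norm_num)
    simp only [extensionSize] at hch hch2 hd ⊢
    linarith
  · have h := expect_avoids_extension_le (k := k) (F := {e, e'}) (by simp [he, he']) hp hpy hy0 hy1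
      (by simpa using h1n)
    refine h.trans (Real.exp_le_exp.2 ?_)
    rw [Finset.card_pair hne, Fintype.card_fin]
    norm_num only [Nat.cast_ofNat]
    simp only [extensionSize] at hch hdep ⊢
    linarith
  · have h := le_expect_inextensible (k := k) he hp hp1
    rw [Fintype.card_fin] at h
    refine le_trans ?_ h
    have ht := (pow_extensionSize_le hk hn3 hp hpx)
    have h1 := exp_neg_le_one_sub (ht.trans hhalf)
    have h2 := pow_le_pow_left₀ (Real.exp_pos _).le h1 ((n - 2).choose k)
    refine le_trans ?_ h2
    rw [← Real.exp_nat_mul, Real.exp_le_exp]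
    have h3 : (((n - 2).choose k : ℕ) : ℝ) ≤ (n : ℝ) ^ k / k.factorial := by
      refine (Nat.choose_le_pow_div k (n - 2)).trans ?_
      gcongr
      omega
    have h4 : (((n - 2).choose k : ℕ) : ℝ) * (p ^ extensionSize k + 2 * (p ^ extensionSize k) ^ 2)
        ≤ meanExtensions k n p + 2 * meanExtensions k n p * p ^ extensionSize k := by
      refine (mul_le_mul_of_nonneg_right h3 (by positivity)).trans (le_of_eq ?_)
      rw [meanExtensions]; ring
    have h5 : 2 * meanExtensions k n p * p ^ extensionSize k ≤ E2 := by
      refine (mul_le_mul (mul_le_mul_of_nonneg_left hM zero_le_two) ht (by positivity)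
        (by positivity)).trans (le_of_eq ?_)
      rw [hE2]; ring
    linarith

/-- Uniform estimates for edge probabilities up to twice the critical one. -/
lemma eventually_expect_inextensible_bounds {k : ℕ} (hk : 1 ≤ k) {η : ℝ} (hη : 0 < η) :
    ∀ᶠ n : ℕ in atTop, ∀ p : ℝ, 0 ≤ p → p ≤ 2 * criticalProb k n →
      (∀ e : Finset (Fin n), e.card = 2 →
        expect (pairProb p) (inextensible k e) ≤ Real.exp (-meanExtensions k n p + η)) ∧
      (∀ e e' : Finset (Fin n), e.card = 2 → e'.card = 2 → e ≠ e' →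
        expect (pairProb p) (avoids (fun i : Finset (Fin n) × Finset (Fin n) => extension i.1 i.2)
          ({e, e'} ×ˢ
            (Finset.univ \ ({e, e'} : Finset (Finset (Fin n))).biUnion id).powersetCard k))
        ≤ Real.exp (-(2 * meanExtensions k n p) + η)) ∧
      (∀ e : Finset (Fin n), e.card = 2 →
        Real.exp (-meanExtensions k n p - η) ≤ expect (pairProb p) (inextensible k e)) := by
  obtain ⟨c, hc, hcn⟩ := exists_le_mul_sqrt_pow k
  have h1 : Tendsto (fun n : ℕ => c * (n : ℝ) ^ (1 / ((k : ℝ) + 3))) atTop atTop :=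
    ((tendsto_rpow_atTop (by positivity)).comp tendsto_natCast_atTop_atTop).const_mul_atTop hc
  have h2 : Tendsto (fun n : ℕ => 2 * criticalProb k n) atTop (𝓝 0) := by
    simpa using (tendsto_criticalProb k).const_mul 2
  have h3 : Tendsto (fun n : ℕ => k.factorial * (rate k * 2 ^ extensionSize k) * (Real.log n / n))
      atTop (𝓝 0) := by
    simpa using (tendsto_log_rpow_div_rpow 1 one_pos).const_mul
      (k.factorial * (rate k * 2 ^ extensionSize k))
  filter_upwards [eventually_ge_atTop (k + 3), h1.eventually_ge_atTop 1,
    h2.eventually_le_const one_pos, h3.eventually_le_const (by norm_num : (0 : ℝ) < 1 / 2),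
    (tendsto_errorBound k c).eventually_le_const hη] with n hn a1 a2 a3 a4 p hp hpx
  exact expect_inextensible_bounds hk hn hc (hcn n (by omega)) (a1.trans (hcn n (by omega))) a2 a3
    a4 hp hpx

end RandomGraph

/-! ### The window, and both sides of the threshold. -/

namespace RandomGraph

open RandomSubset

lemma whpRandomGraph_of_tendsto_real {p : ℕ → unitInterval}
    {P : ∀ n : ℕ, SimpleGraph (Fin n) → Prop}
    (h : Tendsto (fun n => (SimpleGraph.binomialRandom (Fin n) (p n)).real {G | P n G})
      atTop (𝓝 1)) : WhpRandomGraph p P := by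
  rw [WhpRandomGraph, ← ENNReal.tendsto_toReal_iff (fun n => MeasureTheory.measure_ne_top _ _)
    ENNReal.one_ne_top]
  exact h

/-- The relative second-order term of the threshold. -/
noncomputable def windowShift (k n : ℕ) : ℝ :=
  2 * Real.log (Real.log n) / ((k : ℝ) ^ 2 * (((k : ℝ) + 2) ^ 2 + (k + 2)) * Real.log n)

lemma edgeCliqueProb_add_two (k n : ℕ) (w : ℝ) :
    edgeCliqueProb (k + 2) n w
      = criticalProb k n * (1 + windowShift k n + w / Real.log n) := by
  unfold edgeCliqueProb criticalProb windowShift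
  push_cast
  rw [add_sub_cancel_right]

lemma windowShift_nonneg {k n : ℕ} (hn : 3 ≤ n) : 0 ≤ windowShift k n := by
  have hL := log_pos_of_three_le hn
  have := Real.log_pos hL
  unfold windowShift
  positivity

/-- The shift is chosen so that its first-order effect on `M` cancels the `ln ln n` term of
`sq_mul_criticalProb`; the next lemma makes its second-order effect negligible. -/
lemma rate_mul_windowShift {k n : ℕ} (hk : 1 ≤ k) (hn : 3 ≤ n) :
    rate k * extensionSize k * (Real.log n * windowShift k n)
      = 2 / ((k : ℝ) * (k + 3)) * Real.log (Real.log n) := by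
  have hL := log_pos_of_three_le hn
  have hk0 : (0 : ℝ) < k := by positivity
  have hL0 : Real.log n ≠ 0 := by positivity
  rw [rate_mul_extensionSize, windowShift]
  have h : ((k : ℝ) + 2) ^ 2 + (k + 2) = (k + 2) * (k + 3) := by ring
  rw [h]
  field_simp

lemma tendsto_log_mul_windowShift_sq (k : ℕ) :
    Tendsto (fun n : ℕ => Real.log n * windowShift k n ^ 2) atTop (𝓝 0) := by
  have h : Tendsto (fun n : ℕ => Real.log (Real.log n) ^ 2 / Real.log n) atTop (𝓝 0) := by
    have h := (isLittleO_log_rpow_rpow_atTop 2 one_pos).tendsto_div_nhds_zero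
    simp only [Real.rpow_one, Real.rpow_ofNat] at h
    exact h.comp tendsto_log_natCast_atTop
  have h2 := h.const_mul ((2 / ((k : ℝ) ^ 2 * (((k : ℝ) + 2) ^ 2 + (k + 2)))) ^ 2)
  rw [mul_zero] at h2
  refine h2.congr' ?_
  filter_upwards [eventually_ge_atTop 3] with n hn
  have hL := log_pos_of_three_le hn
  have hL0 : Real.log n ≠ 0 := by positivity
  unfold windowShift
  field_simp

lemma tendsto_windowShift (k : ℕ) : Tendsto (windowShift k) atTop (𝓝 0) := by
  have h : Tendsto (fun n : ℕ => windowShift k n ^ 2) atTop (𝓝 0) := by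
    refine squeeze_zero' (Eventually.of_forall fun n => sq_nonneg _) ?_
      (tendsto_log_mul_windowShift_sq k)
    filter_upwards [eventually_ge_atTop 3] with n hn
    exact le_mul_of_one_le_left (sq_nonneg _) (log_pos_of_three_le hn).le
  have h2 := (Real.continuous_sqrt.tendsto 0).comp h
  rw [Real.sqrt_zero] at h2
  refine h2.congr' ?_
  filter_upwards [eventually_ge_atTop 3] with n hn
  exact Real.sqrt_sq (windowShift_nonneg hn)

lemma sq_mul_exp_neg_meanExtensions {k n : ℕ} (hk : 1 ≤ k) (hn : 3 ≤ n) (t : ℝ) :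
    (n : ℝ) ^ 2 * (criticalProb k n * t)
        * Real.exp (-meanExtensions k n (criticalProb k n * t))
      = cliqueConst (k + 2) * t * Real.exp (rate k * Real.log n * (1 - t ^ extensionSize k)
          + 2 / ((k : ℝ) * (k + 3)) * Real.log (Real.log n)) := by
  rw [meanExtensions_criticalProb_mul hk hn, ← mul_assoc, sq_mul_criticalProb hn]
  have : rate k * Real.log n * (1 - t ^ extensionSize k)
          + 2 / ((k : ℝ) * (k + 3)) * Real.log (Real.log n)
      = (rate k * Real.log n + 2 / ((k : ℝ) * (k + 3)) * Real.log (Real.log n))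
        + -(rate k * Real.log n * t ^ extensionSize k) := by ring
  rw [this, Real.exp_add (rate k * Real.log n + _)]
  ring

/-- The value is `k (k + 2)`. Exceeding `2` lets the first moment absorb a factor `n` when `w` is
cut off at `ln n / 2`. -/
lemma three_le_rate_mul_extensionSize {k : ℕ} (hk : 1 ≤ k) : 3 ≤ rate k * extensionSize k := by
  have hk1 : (1 : ℝ) ≤ k := mod_cast hk
  rw [rate_mul_extensionSize]
  nlinarith

/-- Inside the window the expected number of isolated edges is exponentially small in `w`. -/
lemma sq_mul_exp_neg_meanExtensions_le {k n : ℕ} (hk : 1 ≤ k) (hn : 3 ≤ n) {w : ℝ} (hw : 0 ≤ w) :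
    (n : ℝ) ^ 2 * criticalProb k n * Real.exp (-meanExtensions k n
        (criticalProb k n * (1 + windowShift k n + w / Real.log n)))
      ≤ cliqueConst (k + 2) * Real.exp (-(3 * w)) := by
  have hL := log_pos_of_three_le hn
  have hc := cliqueConst_pos k
  have hA := one_le_rate k
  set u := windowShift k n + w / Real.log n with hu
  have hu0 : 0 ≤ u := add_nonneg (windowShift_nonneg hn) (by positivity)
  -- Bernoulli bounds `t ^ m` below by its linear part, so no second-order term arises on this side.
  have h1 := one_add_mul_le_pow (a := u) (by linarith) (extensionSize k)
  have h2 : rate k * extensionSize k * (Real.log n * u)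
      = 2 / ((k : ℝ) * (k + 3)) * Real.log (Real.log n) + rate k * extensionSize k * w := by
    rw [← rate_mul_windowShift hk hn, hu]
    field_simp
  rw [add_assoc, meanExtensions_criticalProb_mul hk hn, sq_mul_criticalProb hn, mul_assoc,
    ← Real.exp_add]
  refine mul_le_mul_of_nonneg_left (Real.exp_le_exp.2 ?_) hc.le
  have h3 := mul_le_mul_of_nonneg_left h1 (by positivity : 0 ≤ rate k * Real.log n)
  have h4 := mul_le_mul_of_nonneg_right (three_le_rate_mul_extensionSize hk) hw
  have h5 : rate k * Real.log n * (1 + extensionSize k * u)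
      = rate k * Real.log n + rate k * extensionSize k * (Real.log n * u) := by ring
  rw [h5, h2] at h3
  linarith

theorem whp_everyEdgeInClique {k : ℕ} (hk : 1 ≤ k) {p : ℕ → unitInterval} {w : ℕ → ℝ}
    (hp : ∀ᶠ n : ℕ in atTop, (p n : ℝ) = edgeCliqueProb (k + 2) n (w n))
    (hw : Tendsto w atTop atTop) :
    WhpRandomGraph p (fun _ G => EveryEdgeInClique (k + 2) G) := by
  refine whpRandomGraph_of_tendsto_real ?_
  suffices h : Tendsto (fun n => (SimpleGraph.binomialRandom (Fin n) (p n)).real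
      {G | ¬ EveryEdgeInClique (k + 2) G}) atTop (𝓝 0) by
    simpa [binomialRandom_real_not] using h.const_sub 1
  set C := cliqueConst (k + 2) * Real.exp 1 with hC
  have hC0 : 0 < C := mul_pos (cliqueConst_pos k) (Real.exp_pos 1)
  have hlim : Tendsto (fun n : ℕ => 2 * C * Real.exp (-w n)
      + C * Real.exp (-(Real.log n / 2))) atTop (𝓝 0) := by
    have h1 : Tendsto (fun n => Real.exp (-w n)) atTop (𝓝 0) :=
      Real.tendsto_exp_neg_atTop_nhds_zero.comp hw
    have h2 : Tendsto (fun n : ℕ => Real.exp (-(Real.log n / 2))) atTop (𝓝 0) :=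
      Real.tendsto_exp_neg_atTop_nhds_zero.comp
        (tendsto_log_natCast_atTop.atTop_div_const two_pos)
    simpa using (h1.const_mul (2 * C)).add (h2.const_mul C)
  refine squeeze_zero' (Eventually.of_forall fun n => MeasureTheory.measureReal_nonneg) ?_ hlim
  filter_upwards [hp, hw.eventually_ge_atTop 0, eventually_ge_atTop 3,
    (tendsto_windowShift k).eventually_le_const (by norm_num : (0 : ℝ) < 1 / 2),
    eventually_one_le_mul_criticalProb hk,
    eventually_expect_inextensible_bounds hk one_pos] with n hp hw hn hs hnx hb
  have hL := log_pos_of_three_le hn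
  have hx := criticalProb_pos (k := k) hn
  have hn0 : (0 : ℝ) < n := by positivity
  have hs0 := windowShift_nonneg (k := k) hn
  rw [edgeCliqueProb_add_two] at hp
  -- The estimates hold only up to twice the critical probability. Cutting off `w` keeps `p'` in
  -- that range, and having no extension is less likely at `p n ≥ p'`.
  set w' := min (w n) (Real.log n / 2) with hw'
  have hw'0 : 0 ≤ w' := le_min hw (by positivity)
  set p' := criticalProb k n * (1 + windowShift k n + w' / Real.log n) with hp'
  have hw'L : w' / Real.log n ≤ 1 / 2 := by
    rw [div_le_iff₀ (by linarith)]
    linarith [min_le_right (w n) (Real.log n / 2)]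
  have hp'0 : 0 ≤ p' := by positivity
  have hp'2 : p' ≤ 2 * criticalProb k n := by
    rw [hp', mul_comm]
    exact mul_le_mul_of_nonneg_right (by linarith) hx.le
  have hp'p : p' ≤ p n := by
    rw [hp, hp']
    gcongr
    exact min_le_left _ _
  have hB : ∀ e : Finset (Fin n), e.card = 2 → expect (pairProb (p n : ℝ)) (inextensible k e)
      ≤ Real.exp (-meanExtensions k n p' + 1) := fun e he =>
    (expect_inextensible_antitone e hp'0 hp'p (p n).2.2).trans ((hb p' hp'0 hp'2).1 e he)
  refine (real_not_everyEdgeInClique_le (p n) hB).trans ?_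
  have hN : (((Fintype.card (Fin n)).choose 2 : ℕ) : ℝ) ≤ (n : ℝ) ^ 2 := by
    rw [Fintype.card_fin]; exact_mod_cast Nat.choose_le_pow n 2
  have hpn := (p n).2.1
  have hmain := sq_mul_exp_neg_meanExtensions_le hk hn hw'0
  rw [← hp'] at hmain
  have hstep : (((Fintype.card (Fin n)).choose 2 : ℕ) : ℝ)
      * (p n * Real.exp (-meanExtensions k n p' + 1))
      ≤ (p n / criticalProb k n) * (C * Real.exp (-(3 * w'))) := by
    calc (((Fintype.card (Fin n)).choose 2 : ℕ) : ℝ)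
          * (p n * Real.exp (-meanExtensions k n p' + 1))
        ≤ (n : ℝ) ^ 2 * (p n * Real.exp (-meanExtensions k n p' + 1)) := by gcongr
      _ = (p n / criticalProb k n) * Real.exp 1
          * ((n : ℝ) ^ 2 * criticalProb k n * Real.exp (-meanExtensions k n p')) := by
          rw [Real.exp_add]; field_simp
      _ ≤ (p n / criticalProb k n) * Real.exp 1
          * (cliqueConst (k + 2) * Real.exp (-(3 * w'))) := by gcongr
      _ = _ := by rw [hC]; ring
  refine hstep.trans ?_
  have e1 := (Real.exp_pos (-w n)).le
  have e2 := (Real.exp_pos (-(Real.log n / 2))).le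
  rcases le_total (w n) (Real.log n / 2) with hle | hle
  · have hww : w' = w n := min_eq_left hle
    have h1 : (p n : ℝ) / criticalProb k n ≤ 2 := by
      rw [div_le_iff₀ hx, hp, ← hww]; exact hp'2
    have h2 : Real.exp (-(3 * w')) ≤ Real.exp (-w n) := Real.exp_le_exp.2 (by rw [hww]; linarith)
    calc _ ≤ 2 * (C * Real.exp (-w n)) := by gcongr
      _ ≤ _ := by nlinarith
  · have hww : w' = Real.log n / 2 := min_eq_right hle
    have h1 : (p n : ℝ) / criticalProb k n ≤ Real.exp (Real.log n) := by
      rw [Real.exp_log hn0, div_le_iff₀ hx]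
      exact (p n).2.2.trans hnx
    -- With `w' = ln n / 2`, the edge factor of at most `n` meets `n ^ (-3 / 2)`.
    calc _ ≤ Real.exp (Real.log n) * (C * Real.exp (-(3 * w'))) := by gcongr
      _ = C * Real.exp (-(Real.log n / 2)) := by
        rw [mul_left_comm, ← Real.exp_add, hww]
        ring_nf
      _ ≤ _ := by nlinarith

/-- As `w` may fall arbitrarily fast, `t = p / criticalProb` can be anywhere from `0` to just above
`1`. For `t > 1` the exponent is at least `-w - 1`; for `1 / 2 ≤ t ≤ 1` the `ln ln n` term suffices.
For `t < 1 / 2`, either `M ≤ 1` and `n ^ 2 p → ∞` is used, or `M > 1` forces `t ≥ 1 / (A ln n)`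
against a gain of `exp (ln n / 2)`. -/
lemma tendsto_sq_mul_exp_neg_meanExtensions {k : ℕ} (hk : 1 ≤ k) {p w : ℕ → ℝ}
    (hp0 : ∀ n, 0 ≤ p n)
    (hp : ∀ᶠ n : ℕ in atTop, p n = edgeCliqueProb (k + 2) n (w n))
    (hn2 : Tendsto (fun n : ℕ => (n : ℝ) ^ 2 * p n) atTop atTop)
    (hw : Tendsto w atTop atBot) :
    Tendsto (fun n : ℕ => (n : ℝ) ^ 2 * p n * Real.exp (-meanExtensions k n (p n)))
      atTop atTop := by
  have hA := one_le_rate k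
  have hc := cliqueConst_pos k
  set c := cliqueConst (k + 2) with hcdef
  set a := 2 / ((k : ℝ) * (k + 3)) with ha
  have hk0 : (0 : ℝ) < k := by positivity
  have ha0 : 0 < a := by positivity
  have hAm := three_le_rate_mul_extensionSize hk
  have hLL : Tendsto (fun n : ℕ => Real.log (Real.log n)) atTop atTop :=
    Real.tendsto_log_atTop.comp tendsto_log_natCast_atTop
  have g1 : Tendsto (fun n : ℕ => c * (1 / 2) * Real.exp (a * Real.log (Real.log n)))
      atTop atTop :=
    (Real.tendsto_exp_atTop.comp (hLL.const_mul_atTop ha0)).const_mul_atTop (by positivity)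
  have g2 : Tendsto (fun n : ℕ => c * Real.exp (-(w n) - 1)) atTop atTop :=
    (Real.tendsto_exp_atTop.comp (tendsto_atTop_add_const_right _ (-1)
      (tendsto_neg_atBot_atTop.comp hw))).const_mul_atTop hc
  have g3 : Tendsto (fun n : ℕ => c * (1 / (rate k * Real.log n))
      * Real.exp (Real.log n / 2)) atTop atTop := by
    have h := (tendsto_exp_div_rpow_atTop 1).comp
      (tendsto_log_natCast_atTop.atTop_div_const two_pos)
    refine (h.const_mul_atTop (by positivity : 0 < c / rate k / 2)).congr fun n => ?_
    simp only [Function.comp, Real.rpow_one]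
    field_simp
  have g4 : Tendsto (fun n : ℕ => (n : ℝ) ^ 2 * p n * Real.exp (-1)) atTop atTop :=
    hn2.atTop_mul_const (Real.exp_pos _)
  have hsq : Tendsto (fun n : ℕ => rate k * extensionSize k ^ 2
      * (Real.log n * windowShift k n ^ 2)) atTop (𝓝 0) := by
    simpa using (tendsto_log_mul_windowShift_sq k).const_mul (rate k * extensionSize k ^ 2)
  have hms : Tendsto (fun n : ℕ => extensionSize k * windowShift k n) atTop (𝓝 0) := by
    simpa using (tendsto_windowShift k).const_mul (extensionSize k : ℝ)
  refine tendsto_atTop.2 fun B => ?_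
  filter_upwards [hp, hw.eventually_le_atBot 0, eventually_ge_atTop 3, g1.eventually_ge_atTop B,
    g2.eventually_ge_atTop B, g3.eventually_ge_atTop B, g4.eventually_ge_atTop B,
    hsq.eventually_le_const one_pos, hms.eventually_le_const one_pos]
    with n hp hw hn h1 h2 h3 h4 h5 h6
  have hL := log_pos_of_three_le hn
  have hLL0 := Real.log_pos hL
  have hx := criticalProb_pos (k := k) hn
  rw [edgeCliqueProb_add_two] at hp
  set t := 1 + windowShift k n + w n / Real.log n with ht
  have hwL : w n / Real.log n ≤ 0 := div_nonpos_of_nonpos_of_nonneg hw (by linarith)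
  have ht0 : 0 ≤ t := by
    have h := hp0 n
    rw [hp] at h
    exact nonneg_of_mul_nonneg_right h hx
  have hform := sq_mul_exp_neg_meanExtensions hk hn t
  rw [← hp, ← ha, ← hcdef] at hform
  have hm1 : extensionSize k ≠ 0 := by
    have := two_mul_extensionSize k
    intro h0
    rw [h0] at this
    have : 0 < k * (k + 3) := by positivity
    omega
  rcases lt_or_ge 1 t with h1t | ht1
  · refine h2.trans ?_
    rw [hform]
    set u := t - 1 with hu
    have hu0 : 0 < u := by linarith
    have hus : u ≤ windowShift k n := by linarith
    have hmu : extensionSize k * u ≤ 1 :=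
      (mul_le_mul_of_nonneg_left hus (Nat.cast_nonneg _)).trans h6
    have hmu0 : 0 ≤ extensionSize k * u := by positivity
    -- From `t ≤ exp u` and `exp y ≤ 1 + y + y ^ 2` for `|y| ≤ 1`; the quadratic part costs the `1`
    -- in the exponent `-w - 1`.
    have hpow : t ^ extensionSize k ≤ 1 + extensionSize k * u + (extensionSize k * u) ^ 2 := by
      have q1 : t ≤ Real.exp u := by linarith [Real.add_one_le_exp u]
      have q2 := pow_le_pow_left₀ ht0 q1 (extensionSize k)
      rw [← Real.exp_nat_mul] at q2
      have q3 := Real.abs_exp_sub_one_sub_id_le (x := extensionSize k * u)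
        (abs_le.2 ⟨by linarith, hmu⟩)
      linarith [(abs_le.1 q3).2]
    have hlin : rate k * Real.log n * (extensionSize k * u)
        = a * Real.log (Real.log n) + rate k * extensionSize k * w n := by
      have hu' : u = windowShift k n + w n / Real.log n := by rw [hu, ht]; ring
      rw [ha, ← rate_mul_windowShift hk hn, hu']
      field_simp
    have hquad : rate k * Real.log n * (extensionSize k * u) ^ 2 ≤ 1 := by
      refine le_trans ?_ h5
      have : rate k * (extensionSize k : ℝ) ^ 2 * (Real.log n * u ^ 2)
          ≤ rate k * extensionSize k ^ 2 * (Real.log n * windowShift k n ^ 2) := by gcongr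
      refine le_trans (le_of_eq (by ring)) this
    have hexp : -(w n) - 1 ≤ rate k * Real.log n * (1 - t ^ extensionSize k)
        + a * Real.log (Real.log n) := by
      have q := mul_le_mul_of_nonneg_left hpow (by positivity : 0 ≤ rate k * Real.log n)
      nlinarith
    calc c * Real.exp (-(w n) - 1) ≤ c * t * Real.exp (-(w n) - 1) := by
          gcongr
          exact le_mul_of_one_le_right hc.le h1t.le
      _ ≤ _ := by gcongr
  · have hpow1 : t ^ extensionSize k ≤ t := pow_le_of_le_one ht0 ht1 hm1
    rcases le_or_gt (1 / 2) t with ht2 | ht2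
    · refine h1.trans ?_
      rw [hform]
      have : 0 ≤ rate k * Real.log n * (1 - t ^ extensionSize k) :=
        mul_nonneg (by positivity) (by linarith)
      gcongr
      linarith
    · rcases le_or_gt (meanExtensions k n (p n)) 1 with hM | hM
      · refine h4.trans ?_
        have := hp0 n
        gcongr
      · refine h3.trans ?_
        rw [hform]
        rw [hp, meanExtensions_criticalProb_mul hk hn] at hM
        have hAL : 0 < rate k * Real.log n := by positivity
        have q1 : 1 / (rate k * Real.log n) ≤ t := by
          rw [div_le_iff₀ hAL]
          nlinarith
        have q2 : Real.log n / 2 ≤ rate k * Real.log n * (1 - t ^ extensionSize k)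
            + a * Real.log (Real.log n) := by
          have q3 : Real.log n ≤ rate k * Real.log n := le_mul_of_one_le_left (by linarith) hA
          have q4 : 0 ≤ a * Real.log (Real.log n) := by positivity
          nlinarith
        gcongr

theorem whp_not_everyEdgeInClique {k : ℕ} (hk : 1 ≤ k) {p : ℕ → unitInterval} {w : ℕ → ℝ}
    (hp : ∀ᶠ n : ℕ in atTop, (p n : ℝ) = edgeCliqueProb (k + 2) n (w n))
    (hn2 : Tendsto (fun n : ℕ => (n : ℝ) ^ 2 * (p n : ℝ)) atTop atTop)
    (hw : Tendsto w atTop atBot) :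
    WhpRandomGraph p (fun _ G => ¬ EveryEdgeInClique (k + 2) G) := by
  refine whpRandomGraph_of_tendsto_real ?_
  -- With `v ≥ 1 / η` the second moment bound becomes `1 / (1 / v + exp (3 η)) ≥ 1 / (η + exp (3
  -- η))`, where `3 η` is `η` from Janson plus `2 η` from squaring the lower bound on the mean.
  have hlim : Tendsto (fun η : ℝ => 1 / (η + Real.exp (3 * η))) (𝓝[>] 0) (𝓝 1) := by
    have h : ContinuousAt (fun η : ℝ => 1 / (η + Real.exp (3 * η))) 0 :=
      ContinuousAt.div continuousAt_const (by fun_prop) (by simp)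
    have h2 := h.tendsto
    simp only [mul_zero, Real.exp_zero, zero_add, div_one] at h2
    exact h2.mono_left nhdsWithin_le_nhds
  have hmean := tendsto_sq_mul_exp_neg_meanExtensions hk (fun n => (p n).2.1) hp hn2 hw
  refine tendsto_order.2 ⟨fun δ hδ => ?_, fun δ hδ => Eventually.of_forall fun n =>
    MeasureTheory.measureReal_le_one.trans_lt hδ⟩
  obtain ⟨η, hη, hη0⟩ := ((hlim.eventually_const_lt hδ).and self_mem_nhdsWithin).exists
  replace hη0 : 0 < η := hη0
  have hg := (hmean.const_mul_atTop (Real.exp_pos (-η))).const_mul_atTop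
    (by norm_num : (0 : ℝ) < 1 / 4)
  filter_upwards [hp, hw.eventually_le_atBot 0, eventually_ge_atTop 3,
    (tendsto_windowShift k).eventually_le_const one_pos, hg.eventually_ge_atTop (1 / η),
    eventually_expect_inextensible_bounds hk hη0] with n hp hw hn hs hv hb
  have hL := log_pos_of_three_le hn
  have hx := criticalProb_pos (k := k) hn
  have hwL : w n / Real.log n ≤ 0 := div_nonpos_of_nonpos_of_nonneg hw (by linarith)
  have hp0 := (p n).2.1
  have hp2 : (p n : ℝ) ≤ 2 * criticalProb k n := by
    rw [hp, edgeCliqueProb_add_two, mul_comm]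
    exact mul_le_mul_of_nonneg_right (by linarith) hx.le
  obtain ⟨-, b2, b3⟩ := hb (p n) hp0 hp2
  set M := meanExtensions k n (p n) with hM
  set N : ℝ := (((Fintype.card (Fin n)).choose 2 : ℕ) : ℝ) with hN
  have hN4 : (n : ℝ) ^ 2 / 4 ≤ N := by
    rw [hN, Fintype.card_fin, Nat.cast_choose_two]
    have : (3 : ℝ) ≤ n := mod_cast hn
    nlinarith
  set v := N * (p n * Real.exp (-M - η)) with hvdef
  have hvη : 1 / η ≤ v := by
    refine hv.trans ?_
    have h1 : (1 / 4 : ℝ) * (Real.exp (-η) * ((n : ℝ) ^ 2 * p n * Real.exp (-M)))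
        = (n : ℝ) ^ 2 / 4 * (p n * Real.exp (-M - η)) := by
      rw [sub_eq_add_neg, Real.exp_add]; ring
    rw [h1]
    exact mul_le_mul_of_nonneg_right hN4 (by positivity)
  have hv0 : 0 < v := lt_of_lt_of_le (by positivity) hvη
  refine hη.trans_le (le_trans ?_ (le_real_not_everyEdgeInClique (p n) b3 hv0 le_rfl b2
    (Real.exp_pos _).le))
  rw [← hN]
  have hU : (N * p n) ^ 2 * Real.exp (-(2 * M) + η) = v ^ 2 * Real.exp (3 * η) := by
    have : Real.exp (-(2 * M) + η) = Real.exp (-M - η) ^ 2 * Real.exp (3 * η) := by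
      rw [← Real.exp_nat_mul, ← Real.exp_add]
      congr 1
      push_cast
      ring
    rw [this, hvdef]
    ring
  rw [hU, div_le_div_iff₀ (by positivity) (by positivity)]
  have h1 : 1 ≤ v * η := by rwa [div_le_iff₀ hη0] at hvη
  nlinarith

/-- Every edge probability is of the form `edgeCliqueProb s n w`. -/
lemma edgeCliqueProb_window {k n : ℕ} (hn : 3 ≤ n) (q : ℝ) :
    q = edgeCliqueProb (k + 2) n
      ((q / criticalProb k n - 1 - windowShift k n) * Real.log n) := by
  have hL := log_pos_of_three_le hn
  have hx := criticalProb_pos (k := k) hn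
  have hL0 : Real.log n ≠ 0 := by positivity
  rw [edgeCliqueProb_add_two]
  field_simp
  ring

lemma tendsto_sub_windowShift_mul_log {k : ℕ} {ε : ℝ} (hε : 0 < ε) :
    Tendsto (fun n : ℕ => (ε - windowShift k n) * Real.log n) atTop atTop :=
  Tendsto.pos_mul_atTop hε (by simpa using (tendsto_windowShift k).const_sub ε)
    tendsto_log_natCast_atTop

end RandomGraph

open RandomGraph in
theorem mainTheorem4 (s : ℕ) (hs : 3 ≤ s) :
    -- the window above the threshold
    (∀ (p : ℕ → unitInterval) (w : ℕ → ℝ),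
      (∀ᶠ n : ℕ in atTop, (p n : ℝ) = edgeCliqueProb s n (w n)) →
      Tendsto w atTop atTop →
      WhpRandomGraph p (fun _ G => EveryEdgeInClique s G)) ∧
    -- the window below the threshold
    (∀ (p : ℕ → unitInterval) (w : ℕ → ℝ),
      (∀ᶠ n : ℕ in atTop, (p n : ℝ) = edgeCliqueProb s n (w n)) →
      Tendsto (fun n : ℕ => (n : ℝ) ^ 2 * (p n : ℝ)) atTop atTop →
      Tendsto w atTop atBot →
      WhpRandomGraph p (fun _ G => ¬ EveryEdgeInClique s G)) ∧
    -- sharpness of the threshold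
    (∀ ε : ℝ, 0 < ε → ∀ p : ℕ → unitInterval,
      ((∀ᶠ n : ℕ in atTop, (1 + ε) * (cliqueConst s * cliqueScale s n) ≤ (p n : ℝ)) →
        WhpRandomGraph p (fun _ G => EveryEdgeInClique s G)) ∧
      ((∀ᶠ n : ℕ in atTop, (p n : ℝ) ≤ (1 - ε) * (cliqueConst s * cliqueScale s n)) →
        Tendsto (fun n : ℕ => (n : ℝ) ^ 2 * (p n : ℝ)) atTop atTop →
        WhpRandomGraph p (fun _ G => ¬ EveryEdgeInClique s G))) := by
  obtain ⟨k, rfl⟩ : ∃ k, s = k + 2 := ⟨s - 2, by omega⟩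
  have hk : 1 ≤ k := by omega
  refine ⟨fun p w hp hw => whp_everyEdgeInClique hk hp hw,
    fun p w hp hn2 hw => whp_not_everyEdgeInClique hk hp hn2 hw, fun ε hε p => ?_⟩
  -- Sharpness reduces to the window statements by solving for `w`: it is at least `(ε - windowShift
  -- k n) ln n` above the threshold and at most `-ε ln n` below.
  have hwin : ∀ᶠ n : ℕ in atTop, (p n : ℝ) = edgeCliqueProb (k + 2) n
      (((p n : ℝ) / criticalProb k n - 1 - windowShift k n) * Real.log n) := by
    filter_upwards [eventually_ge_atTop 3] with n hn
    exact edgeCliqueProb_window hn _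
  refine ⟨fun h => whp_everyEdgeInClique hk hwin ?_,
    fun h hn2 => whp_not_everyEdgeInClique hk hwin hn2 ?_⟩
  · refine tendsto_atTop_mono' _ ?_ (tendsto_sub_windowShift_mul_log (k := k) hε)
    filter_upwards [h, eventually_ge_atTop 3] with n h hn
    have hL := log_pos_of_three_le hn
    have h1 : 1 + ε ≤ p n / criticalProb k n := (le_div_iff₀ (criticalProb_pos hn)).2 h
    gcongr
    linarith
  · refine tendsto_atBot_mono' _ ?_
      (tendsto_neg_atTop_atBot.comp (tendsto_log_natCast_atTop.const_mul_atTop hε))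
    filter_upwards [h, eventually_ge_atTop 3] with n h hn
    have hL := log_pos_of_three_le hn
    have hs0 := windowShift_nonneg (k := k) hn
    have h1 : p n / criticalProb k n ≤ 1 - ε := (div_le_iff₀ (criticalProb_pos hn)).2 h
    simp only [Function.comp]
    rw [← neg_mul]
    gcongr
    linarith
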